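/- Let $\mathcal S_n$ be the set of permutations of $[n]=\{1,\dots,n\}$. For $\sigma\in\mathcal S_n$ and $j\in[n]$ put $\mathrm{Inv}_j(\sigma)=|\{i<j:\sigma(i)>\sigma(j)\}|$ and $\mathrm{Inv}(\sigma)=|\{(i,j):i<j,\ \sigma(i)>\sigma(j)\}|$. For $q\in[0,\infty)$ let $\pi_{n,q}$ be the Mallows distribution on $\mathcal S_n$, $\pi_{n,q}(\sigma)=q^{\mathrm{Inv}(\sigma)}/Z_{n,q}$ with $Z_{n,q}=\prod_{k=1}^n\sum_{\ell=0}^{k-1}q^\ell$. A Mallows process is an $\mathcal S_n$-valued càdlàg stochastic process $(\mathcal M_t)_{t\in[0,\infty)}$ such that $\mathcal M_t$ has law $\pi_{n,t}$ for every $t\ge 0$. It is - monotone if almost surely $\mathrm{Inv}(\mathcal M_t)\le\mathrm{Inv}(\mathcal M_{t'})$ for all $t<t'$; - strongly monotone if moreover almost surely $\mathrm{Inv}_j(\mathcal M_t)\le\mathrm{Inv}_j(\mathcal M_{t'})$ for all $j\in[n]$ and $t<t'$; - smooth if it is strongly monotone and almost surely $\mathrm{Inv}(\mathcal M_t)\le\mathrm{Inv}(\mathcal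 M_{t-})+1$ for all $t$; - regular if it is smooth and the processes $(\mathrm{Inv}_j(\mathcal M_t))_{t\in[0,\infty)}$, $j\in[n]$, are independent. For each $n$, let $(\mathcal M^n_t)_{t\in[0,\infty)}$ be a monotone Mallows process on $\mathcal S_n$ (the processes for different $n$ may live on different probability spaces), with jumping times $$T_k=T^n_k=\inf\{t\in[0,\infty):\mathrm{Inv}(\mathcal M^n_t)\ge k\},\qquad 1\le k\le\tbinom n2 .$$ Then for every fixed integer $k\ge1$, as $n\to\infty$, $$nT_k\ \overset{d}{\longrightarrow}\ \mathrm{Gamma}(k,1)$$ (shape $k$, rate $1$). Moreover, if $\mathcal M^n$ is regular for every $n$, then $$(nT_1,\dots,nT_k)\ \overset{d}{\longrightarrow}\ \mathrm{PP}_k(1),$$ where $\mathrm{PP}_k(1)$ is the joint distribution of the first $k$ points, in increasing order, of a homogeneous Poisson point process with rate $1$ on $[0,\infty)$. -/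

import Mathlib

open MeasureTheory ProbabilityTheory Filter Topology
open scoped NNReal ENNReal

namespace Mallows

/-- The finite set of permutations of `{1, …, n}` carries the discrete topology. -/
instance permTopologicalSpace (n : ℕ) : TopologicalSpace (Equiv.Perm (Fin n)) := ⊥

instance permDiscreteTopology (n : ℕ) : DiscreteTopology (Equiv.Perm (Fin n)) := ⟨rfl⟩

/-- The finite set of permutations of `{1, …, n}` carries the discrete σ-algebra. -/
instance permMeasurableSpace (n : ℕ) : MeasurableSpace (Equiv.Perm (Fin n)) := ⊤

instance permDiscreteMeasurableSpace (n : ℕ) :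
    DiscreteMeasurableSpace (Equiv.Perm (Fin n)) := ⟨fun _ => trivial⟩

/-- `Inv_j(σ)`: the number of `i < j` with `σ(i) > σ(j)`. -/
def invAt {n : ℕ} (j : Fin n) (σ : Equiv.Perm (Fin n)) : ℕ :=
  (Finset.univ.filter fun i : Fin n => i < j ∧ σ j < σ i).card

/-- `Inv(σ)`: the number of pairs `i < j` with `σ(i) > σ(j)`. -/
def inv {n : ℕ} (σ : Equiv.Perm (Fin n)) : ℕ :=
  (Finset.univ.filter fun p : Fin n × Fin n => p.1 < p.2 ∧ σ p.2 < σ p.1).card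

/-- The normalizing constant `Z_{n,q} = ∏_{k=1}^n ∑_{ℓ=0}^{k-1} q^ℓ`. -/
noncomputable def Z (n : ℕ) (q : ℝ≥0) : ℝ≥0 :=
  ∏ k ∈ Finset.Icc 1 n, ∑ l ∈ Finset.range k, q ^ l

/-- The Mallows distribution `π_{n,q}`, with mass `q^{Inv(σ)} / Z_{n,q}` at each `σ`. -/
noncomputable def mallowsMeasure (n : ℕ) (q : ℝ≥0) : Measure (Equiv.Perm (Fin n)) :=
  Measure.sum fun σ => ((q ^ inv σ / Z n q : ℝ≥0) : ℝ≥0∞) • Measure.dirac σ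

/-- A path indexed by `[0,∞)` is càdlàg: right-continuous everywhere, with left limits at every
`t > 0`. -/
def IsCadlag {E : Type*} [TopologicalSpace E] (f : ℝ≥0 → E) : Prop :=
  (∀ t, ContinuousWithinAt f (Set.Ioi t) t) ∧ ∀ t, 0 < t → ∃ x, Tendsto f (𝓝[<] t) (𝓝 x)

section RandomObjects

variable {Ω : Type*} [MeasurableSpace Ω] {n : ℕ}

/-- Mallows process: a permutation-valued stochastic process with (almost surely) càdlàg paths
whose value at time `t` has law `π_{n,t}`. -/
structure IsMallowsProcess (M : ℝ≥0 → Ω → Equiv.Perm (Fin n)) (P : Measure Ω) : Prop where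
  measurable : ∀ t, Measurable (M t)
  cadlag : ∀ᵐ ω ∂P, IsCadlag fun t => M t ω
  law : ∀ t, P.map (M t) = mallowsMeasure n t

/-- Monotone Mallows process: almost surely `Inv(M_s) ≤ Inv(M_t)` for all `s < t`. -/
structure IsMonotone (M : ℝ≥0 → Ω → Equiv.Perm (Fin n)) (P : Measure Ω) : Prop
    extends IsMallowsProcess M P where
  inv_le : ∀ᵐ ω ∂P, ∀ s t, s < t → inv (M s ω) ≤ inv (M t ω)

/-- Strongly monotone Mallows process: moreover almost surely `Inv_j(M_s) ≤ Inv_j(M_t)` for all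
`j` and all `s < t`. -/
structure IsStronglyMonotone (M : ℝ≥0 → Ω → Equiv.Perm (Fin n)) (P : Measure Ω) : Prop
    extends IsMonotone M P where
  invAt_le : ∀ᵐ ω ∂P, ∀ j s t, s < t → invAt j (M s ω) ≤ invAt j (M t ω)

/-- Smooth Mallows process: strongly monotone, and almost surely `Inv(M_t) ≤ Inv(M_{t-}) + 1`
for all `t`. Here `Function.leftLim` is the left limit `M_{t-}`, with `M_{0-} = M_0`. -/
structure IsSmooth (M : ℝ≥0 → Ω → Equiv.Perm (Fin n)) (P : Measure Ω) : Prop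
    extends IsStronglyMonotone M P where
  inv_le_leftLim : ∀ᵐ ω ∂P, ∀ t,
    inv (M t ω) ≤ inv (Function.leftLim (fun s => M s ω) t) + 1

/-- Regular Mallows process: smooth, and the processes `(Inv_j(M_t))_{t ≥ 0}`, as random elements
of the path space `ℝ≥0 → ℕ` with its product σ-algebra, are independent over `j`. -/
structure IsRegular (M : ℝ≥0 → Ω → Equiv.Perm (Fin n)) (P : Measure Ω) : Prop
    extends IsSmooth M P where
  indep : iIndepFun (fun (j : Fin n) (ω : Ω) (t : ℝ≥0) => invAt j (M t ω)) P

/-- The jumping time `T_k = inf {t ≥ 0 : Inv(M_t) ≥ k}`. For `k ≤ n(n-1)/2` and a Mallows process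
the set is almost surely nonempty; where it is empty, the value is `0`. -/
noncomputable def jumpTime (M : ℝ≥0 → Ω → Equiv.Perm (Fin n)) (k : ℕ) (ω : Ω) : ℝ :=
  ((sInf {t : ℝ≥0 | k ≤ inv (M t ω)} : ℝ≥0) : ℝ)

/-- Homogeneous Poisson point process on `[0,∞)` with rate `lam`: a random subset `N` of `[0,∞)`
such that the number of points in a Borel set `B ⊆ [0,∞)` of finite Lebesgue measure `|B|` is
Poisson distributed with parameter `lam * |B|`, and the numbers of points in pairwise disjoint
Borel sets are independent. -/
structure IsPoissonPointProcess (N : Ω → Set ℝ) (lam : ℝ≥0) (P : Measure Ω) : Prop where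
  subset : ∀ ω, N ω ⊆ Set.Ici 0
  measurable : ∀ B : Set ℝ, MeasurableSet B → Measurable fun ω => (N ω ∩ B).encard
  law : ∀ B : Set ℝ, MeasurableSet B → B ⊆ Set.Ici 0 → volume B ≠ ∞ → ∀ m : ℕ,
    P {ω | (N ω ∩ B).encard = m} = poissonMeasure (lam * (volume B).toNNReal) {m}
  indep : ∀ (m : ℕ) (B : Fin m → Set ℝ), (∀ i, MeasurableSet (B i)) →
    Pairwise (Function.onFun Disjoint B) → iIndepFun (fun i ω => (N ω ∩ B i).encard) P

end RandomObjects

/-- The `i`-th smallest point (`i = 1, 2, …`) of a subset `S` of `[0,∞)` that is infinite and has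
finitely many points in each bounded interval. -/
noncomputable def nthPoint (S : Set ℝ) (i : ℕ) : ℝ :=
  sInf {t : ℝ | 0 ≤ t ∧ (i : ℕ∞) ≤ (S ∩ Set.Icc 0 t).encard}

end Mallows

/-! By Lehmer's bijection, under `π_{n,q}` the inversion counts `Inv_j` are independent truncated
geometric variables with parameter `q`. At `q = x / n` all of them but the first are nearly
Bernoulli with parameter `x / n`, so Le Cam's argument (total variation errors add up along
convolutions of independent summands) shows that `Inv` is asymptotically Poisson with mean `x`.
Since `n T_k ≤ x` if and only if `Inv(M_{x/n}) ≥ k`, the distribution function of `n T_k` at `x`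
converges to the probability that a Poisson variable with mean `x` is at least `k`, which is the
distribution function of `Gamma(k, 1)` at `x`.

When the coordinate processes are independent, the vector of increments of `Inv_j` over finitely
many time intervals is, up to an event of probability `O(n⁻²)`, zero or a unit vector. The same
argument makes the increments of `Inv` asymptotically independent Poisson variables, like those of
the counting function of the Poisson process, and the law of the hitting times of a monotone
integer-valued process is determined by its finite-dimensional distributions. -/

section PoissonApproximation

lemma abs_conv_sub_conv_le {E : Type*} [AddCommMonoid E] [MeasurableSpace E] [MeasurableAdd₂ E]
    {μ₁ μ₂ ν₁ ν₂ : Measure E} [IsProbabilityMeasure μ₁] [IsProbabilityMeasure μ₂]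
    [IsProbabilityMeasure ν₁] [IsProbabilityMeasure ν₂] {a b : ℝ}
    (h₁ : ∀ A, MeasurableSet A → |μ₁.real A - ν₁.real A| ≤ a)
    (h₂ : ∀ A, MeasurableSet A → |μ₂.real A - ν₂.real A| ≤ b)
    {A : Set E} (hA : MeasurableSet A) : |(μ₁ ∗ μ₂).real A - (ν₁ ∗ ν₂).real A| ≤ a + b := by
  have conv_left (ρ μ ν : Measure E) [IsProbabilityMeasure ρ] [IsProbabilityMeasure μ]
      [IsProbabilityMeasure ν] (c : ℝ) (h : ∀ A, MeasurableSet A → |μ.real A - ν.real A| ≤ c) :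
      |(ρ ∗ μ).real A - (ρ ∗ ν).real A| ≤ c := by
    have hpre : MeasurableSet ((fun z : E × E => z.1 + z.2) ⁻¹' A) := measurable_add hA
    have real_conv (κ : Measure E) [IsProbabilityMeasure κ] :
        (ρ ∗ κ).real A = ∫ x, κ.real ((x + ·) ⁻¹' A) ∂ρ := by
      rw [Measure.conv, map_measureReal_apply measurable_add hA, measureReal_def,
        Measure.prod_apply hpre]
      exact (integral_toReal (measurable_measure_prodMk_left hpre).aemeasurable
        (ae_of_all _ fun _ => measure_lt_top _ _)).symm
    have integrable_section (κ : Measure E) [IsProbabilityMeasure κ] :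
        Integrable (fun x => κ.real ((x + ·) ⁻¹' A)) ρ :=
      Integrable.of_bound (measurable_measure_prodMk_left hpre).ennreal_toReal.aestronglyMeasurable
        1 (ae_of_all _ fun x => by
          rw [Real.norm_of_nonneg measureReal_nonneg]; exact measureReal_le_one)
    rw [real_conv, real_conv, ← integral_sub (integrable_section μ) (integrable_section ν)]
    simpa using norm_integral_le_of_norm_le_const (μ := ρ)
      (f := fun x => μ.real ((x + ·) ⁻¹' A) - ν.real ((x + ·) ⁻¹' A))
      (ae_of_all _ fun x => h _ (measurable_const_add x hA))
  calc |(μ₁ ∗ μ₂).real A - (ν₁ ∗ ν₂).real A|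
      ≤ |(μ₁ ∗ μ₂).real A - (μ₁ ∗ ν₂).real A| + |(μ₁ ∗ ν₂).real A - (ν₁ ∗ ν₂).real A| :=
        abs_sub_le _ _ _
    _ ≤ a + b := by
        rw [add_comm a]
        refine add_le_add (conv_left μ₁ μ₂ ν₂ b h₂) ?_
        rw [Measure.conv_comm μ₁ ν₂, Measure.conv_comm ν₁ ν₂]
        exact conv_left ν₂ μ₁ ν₁ a h₁

lemma poissonMeasure_zero : poissonMeasure 0 = Measure.dirac 0 := by
  refine Measure.ext_of_singleton fun m => ?_
  rcases eq_or_ne m 0 with rfl | hm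
  · simp [poissonMeasure_singleton]
  · simp [poissonMeasure_singleton, hm, hm.symm]

variable {ι : Type*} [Fintype ι]

lemma pi_conv_pi {E : Type*} [AddMonoid E] [MeasurableSpace E] [MeasurableAdd₂ E]
    (μ ν : ι → Measure E) [∀ i, IsProbabilityMeasure (μ i)] [∀ i, IsProbabilityMeasure (ν i)] :
    Measure.pi μ ∗ Measure.pi ν = Measure.pi fun i => μ i ∗ ν i := by
  have hadd : Measurable fun z : E × E => z.1 + z.2 := measurable_add
  calc Measure.pi μ ∗ Measure.pi ν
      = (Measure.pi fun i => (μ i).prod (ν i)).map fun f i => (f i).1 + (f i).2 := by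
        rw [Measure.conv, ← (measurePreserving_arrowProdEquivProdArrow E E ι μ ν).map_eq,
          Measure.map_map (by fun_prop) (MeasurableEquiv.measurable _)]
        rfl
    _ = Measure.pi fun i => μ i ∗ ν i :=
        Measure.pi_map_pi fun i => hadd.aemeasurable

/-- The law of a vector of independent Poisson variables with rates `r l`. -/
noncomputable def poissonPi (r : ι → ℝ≥0) : Measure (ι → ℕ) :=
  Measure.pi fun l => poissonMeasure (r l)

instance poissonPi.isProbabilityMeasure (r : ι → ℝ≥0) : IsProbabilityMeasure (poissonPi r) :=
  inferInstanceAs (IsProbabilityMeasure (Measure.pi _))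

lemma poissonPi_conv_poissonPi (r r' : ι → ℝ≥0) :
    poissonPi r ∗ poissonPi r' = poissonPi (r + r') := by
  simp only [poissonPi, pi_conv_pi, poissonMeasure_conv_poissonMeasure, Pi.add_apply]

lemma poissonPi_real_singleton (r : ι → ℝ≥0) (x : ι → ℕ) :
    (poissonPi r).real {x} = ∏ l, Real.exp (-r l) * r l ^ x l / (x l).factorial := by
  simp only [poissonPi, measureReal_def, Measure.pi_singleton, ENNReal.toReal_prod]
  exact Finset.prod_congr rfl fun l _ => poissonMeasure_real_singleton _ _

lemma poissonPi_real_zero (r : ι → ℝ≥0) :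
    (poissonPi r).real {0} = Real.exp (-∑ l, r l) := by
  simp [poissonPi_real_singleton, ← Real.exp_sum]

lemma poissonPi_zero : poissonPi (0 : ι → ℝ≥0) = Measure.dirac 0 := by
  classical
  refine Measure.ext_of_singleton fun x => ?_
  simp [poissonPi, Measure.pi_singleton, poissonMeasure_zero, Set.indicator_apply,
    Finset.prod_ite_zero, funext_iff]

variable [DecidableEq ι]

lemma poissonPi_real_single (r : ι → ℝ≥0) (l : ι) :
    (poissonPi r).real {Pi.single l 1} = Real.exp (-∑ i, r i) * r l := by
  have hexp : Real.exp (-∑ i, r i) = ∏ i, Real.exp (-r i) := by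
    rw [← Real.exp_sum, NNReal.coe_sum, Finset.sum_neg_distrib]
  rw [poissonPi_real_singleton, hexp]
  simp only [mul_div_assoc, Finset.prod_mul_distrib]
  congr 1
  rw [Fintype.prod_eq_single l fun i hi => by simp [hi]]
  simp

lemma eq_zero_or_eq_single_of_sum_lt_two {x : ι → ℕ} (hx : ∑ l, x l < 2) :
    x = 0 ∨ ∃ l, x = Pi.single l 1 := by
  rcases eq_or_ne x 0 with h0 | h0
  · exact Or.inl h0
  obtain ⟨l, hl⟩ := Function.ne_iff.1 h0
  have hsplit := Finset.add_sum_erase Finset.univ x (Finset.mem_univ l)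
  have hrest : ∑ i ∈ Finset.univ.erase l, x i = 0 := by
    have : x l ≠ 0 := hl
    omega
  refine Or.inr ⟨l, funext fun i => ?_⟩
  rcases eq_or_ne i l with rfl | hi
  · simp; have : x i ≠ 0 := hl; omega
  · simpa [hi] using (Finset.sum_eq_zero_iff.1 hrest) i (by simp [hi])

lemma measureReal_eq_add_sum_single_add (μ : Measure (ι → ℕ)) [IsFiniteMeasure μ]
    (A : Set (ι → ℕ)) :
    μ.real A = μ.real (A ∩ {0}) + ∑ l, μ.real (A ∩ {Pi.single l 1}) +
      μ.real (A ∩ {x | 2 ≤ ∑ l, x l}) := by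
  have hcover : A = (A ∩ {0}) ∪ (⋃ l : ι, A ∩ {Pi.single l 1}) ∪ (A ∩ {x | 2 ≤ ∑ l, x l}) := by
    rw [← Set.inter_iUnion, ← Set.inter_union_distrib_left, ← Set.inter_union_distrib_left]
    refine (Set.inter_eq_left.2 fun x _ => ?_).symm
    rcases lt_or_ge (∑ l, x l) 2 with h | h
    · rcases eq_zero_or_eq_single_of_sum_lt_two h with rfl | ⟨l, rfl⟩ <;> simp
    · exact Or.inr h
  have hsum (l : ι) : ∑ i, (Pi.single l 1 : ι → ℕ) i = 1 := by simp
  conv_lhs => rw [hcover]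
  rw [measureReal_union _ .of_discrete, measureReal_union _ .of_discrete,
    measureReal_iUnion_fintype _ fun _ => .of_discrete]
  · intro l l' hl
    refine Set.disjoint_left.2 ?_
    rintro x ⟨-, rfl⟩ ⟨-, h⟩
    have := congrFun (h : Pi.single l 1 = Pi.single l' 1) l
    simp [hl] at this
  · refine Set.disjoint_left.2 ?_
    rintro x ⟨-, rfl⟩ h
    obtain ⟨l, -, h⟩ := Set.mem_iUnion.1 h
    have := congrFun (h : 0 = Pi.single l 1) l
    simp at this
  · refine Set.disjoint_left.2 ?_
    rintro x (⟨-, rfl⟩ | h) ⟨-, h2⟩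
    · simp at h2
    · obtain ⟨l, -, rfl⟩ := Set.mem_iUnion.1 h
      simp [hsum] at h2

lemma one_sub_exp_neg_mul_one_add_le_sq (x : ℝ) (hx : 0 ≤ x) :
    1 - Real.exp (-x) * (1 + x) ≤ x ^ 2 := by
  nlinarith [Real.add_one_le_exp (-x)]

omit [DecidableEq ι] in
lemma poissonPi_real_setOf_two_le_sum_le (r : ι → ℝ≥0) :
    (poissonPi r).real {x | 2 ≤ ∑ l, x l} ≤ (∑ l, (r l : ℝ)) ^ 2 := by
  classical
  have htotal := measureReal_eq_add_sum_single_add (poissonPi r) Set.univ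
  simp only [Set.univ_inter, probReal_univ, poissonPi_real_zero, poissonPi_real_single,
    NNReal.coe_sum, ← Finset.mul_sum] at htotal
  have := one_sub_exp_neg_mul_one_add_le_sq (∑ l, (r l : ℝ)) (by positivity)
  linarith

lemma abs_measureReal_inter_single_sub_poissonPi_le (μ : Measure (ι → ℕ)) (r : ι → ℝ≥0)
    (A : Set (ι → ℕ)) (l : ι) :
    |μ.real (A ∩ {Pi.single l 1}) - (poissonPi r).real (A ∩ {Pi.single l 1})| ≤
      |μ.real {Pi.single l 1} - r l| + r l * ∑ i, (r i : ℝ) := by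
  by_cases hl : Pi.single l 1 ∈ A
  · rw [Set.inter_eq_right.2 (Set.singleton_subset_iff.2 hl), poissonPi_real_single,
      NNReal.coe_sum]
    have hexp : |(r l : ℝ) - Real.exp (-∑ i, (r i : ℝ)) * r l| ≤ r l * ∑ i, (r i : ℝ) := by
      have hle : Real.exp (-∑ i, (r i : ℝ)) ≤ 1 :=
        Real.exp_le_one_iff.2 (neg_nonpos.2 (by positivity))
      have hge := Real.add_one_le_exp (-∑ i, (r i : ℝ))
      rw [abs_of_nonneg] <;> nlinarith [(r l).coe_nonneg]
    exact (abs_sub_le _ (r l : ℝ) _).trans (by gcongr)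
  · rw [Set.inter_singleton_eq_empty.2 hl]
    simp only [measureReal_empty, sub_zero, abs_zero]
    positivity

/- For a small rate `r`, both laws live on `0` and the unit vectors up to an error of second order
in `r`; the atom at `0` is accounted for by passing to the complement of `A`. -/
lemma abs_measureReal_sub_poissonPi_le (μ : Measure (ι → ℕ)) [IsProbabilityMeasure μ]
    (r : ι → ℝ≥0) (A : Set (ι → ℕ)) :
    |μ.real A - (poissonPi r).real A| ≤ μ.real {x | 2 ≤ ∑ l, x l} +
      ∑ l, |μ.real {Pi.single l 1} - r l| + 2 * (∑ l, (r l : ℝ)) ^ 2 := by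
  wlog h0 : 0 ∉ A generalizing A
  · have hcompl := this Aᶜ (by simpa using h0)
    rw [probReal_compl_eq_one_sub .of_discrete, probReal_compl_eq_one_sub .of_discrete,
      abs_sub_comm] at hcompl
    convert hcompl using 2
    ring
  set ν := poissonPi r
  set B : Set (ι → ℕ) := {x | 2 ≤ ∑ l, x l}
  have hbig : |μ.real (A ∩ B) - ν.real (A ∩ B)| ≤ μ.real B + (∑ l, (r l : ℝ)) ^ 2 := by
    have hμ : μ.real (A ∩ B) ≤ μ.real B := measureReal_mono Set.inter_subset_right
    have hν : ν.real (A ∩ B) ≤ (∑ l, (r l : ℝ)) ^ 2 :=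
      (measureReal_mono Set.inter_subset_right).trans (poissonPi_real_setOf_two_le_sum_le r)
    rw [abs_le]
    constructor <;> linarith [measureReal_nonneg (μ := μ) (s := A ∩ B),
      measureReal_nonneg (μ := ν) (s := A ∩ B), measureReal_nonneg (μ := μ) (s := B),
      sq_nonneg (∑ l, (r l : ℝ))]
  have hsum : |∑ l, μ.real (A ∩ {Pi.single l 1}) - ∑ l, ν.real (A ∩ {Pi.single l 1})| ≤
      ∑ l, |μ.real {Pi.single l 1} - r l| + (∑ l, (r l : ℝ)) ^ 2 := by
    rw [← Finset.sum_sub_distrib, sq, Finset.sum_mul, ← Finset.sum_add_distrib]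
    exact (Finset.abs_sum_le_sum_abs _ _).trans (Finset.sum_le_sum fun l _ =>
      abs_measureReal_inter_single_sub_poissonPi_le μ r A l)
  rw [measureReal_eq_add_sum_single_add μ A, measureReal_eq_add_sum_single_add ν A,
    Set.inter_singleton_eq_empty.2 h0, measureReal_empty, measureReal_empty]
  rw [abs_le] at hbig hsum ⊢
  constructor <;> linarith [hbig.1, hbig.2, hsum.1, hsum.2]

theorem abs_measureReal_sum_sub_poissonPi_le {Ω J : Type*} [MeasurableSpace Ω] {P : Measure Ω}
    [IsProbabilityMeasure P] {X : J → Ω → ι → ℕ} (hX : ∀ j, Measurable (X j)) (hind : iIndepFun X P)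
    (r : J → ι → ℝ≥0) (s : Finset J) (A : Set (ι → ℕ)) :
    |P.real {ω | ∑ j ∈ s, X j ω ∈ A} - (poissonPi (∑ j ∈ s, r j)).real A| ≤
      ∑ j ∈ s, (P.real {ω | 2 ≤ ∑ l, X j ω l} + ∑ l, |P.real {ω | X j ω = Pi.single l 1} - r j l| +
        2 * (∑ l, (r j l : ℝ)) ^ 2) := by
  classical
  have hsum (s : Finset J) : Measurable (∑ j ∈ s, X j) := by
    simpa only [Finset.sum_fn] using Finset.measurable_sum s fun j _ => hX j
  have hlaw (s : Finset J) : P.real {ω | ∑ j ∈ s, X j ω ∈ A} = (P.map (∑ j ∈ s, X j)).real A := by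
    rw [map_measureReal_apply (hsum s) .of_discrete]
    simp [Set.preimage]
  rw [hlaw]
  clear hlaw
  induction s using Finset.induction_on generalizing A with
  | empty =>
    have hmap : P.map (0 : Ω → ι → ℕ) = Measure.dirac 0 :=
      (Measure.map_const P (0 : ι → ℕ)).trans (by rw [measure_univ, one_smul])
    simp [hmap, poissonPi_zero]
  | insert j s hj ih =>
    have hindep : IndepFun (X j) (∑ i ∈ s, X i) P :=
      (hind.indepFun_finsetSum_of_notMem hX hj).symm
    have := Measure.isProbabilityMeasure_map (hX j).aemeasurable (μ := P)
    have := Measure.isProbabilityMeasure_map (hsum s).aemeasurable (μ := P)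
    rw [Finset.sum_insert hj, Finset.sum_insert hj, Finset.sum_insert hj,
      hindep.map_add_eq_map_conv_map (hX j) (hsum s), ← poissonPi_conv_poissonPi]
    refine abs_conv_sub_conv_le (fun B _ => ?_) (fun B _ => ih B) .of_discrete
    have hstep := abs_measureReal_sub_poissonPi_le (P.map (X j)) (r j) B
    simpa only [map_measureReal_apply (hX j) .of_discrete, Set.preimage, Set.mem_singleton_iff,
      Set.mem_ofPred_eq] using hstep

theorem tendsto_measure_sum_mem_poissonPi {Ω : ℕ → Type*} [∀ n, MeasurableSpace (Ω n)]
    {P : ∀ n, Measure (Ω n)} [∀ n, IsProbabilityMeasure (P n)] {ι : Type*} [Fintype ι]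
    [DecidableEq ι] {X : ∀ n, Fin n → Ω n → ι → ℕ} (hX : ∀ n j, Measurable (X n j))
    (hind : ∀ n, iIndepFun (X n) (P n)) (r : ι → ℝ≥0)
    (hone : ∀ l, Tendsto (fun n : ℕ => ∑ j, |(P n).real {ω | X n j ω = Pi.single l 1} - r l / n|)
      atTop (𝓝 0))
    (htwo : Tendsto (fun n => ∑ j, (P n).real {ω | 2 ≤ ∑ l, X n j ω l}) atTop (𝓝 0))
    (A : Set (ι → ℕ)) :
    Tendsto (fun n => P n {ω | ∑ j, X n j ω ∈ A}) atTop (𝓝 (poissonPi r A)) := by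
  rw [← ENNReal.tendsto_toReal_iff (fun _ => measure_ne_top _ _) (measure_ne_top _ _),
    tendsto_iff_norm_sub_tendsto_zero]
  have hbound : Tendsto (fun n : ℕ => ∑ j, (P n).real {ω | 2 ≤ ∑ l, X n j ω l} +
      ∑ l, ∑ j, |(P n).real {ω | X n j ω = Pi.single l 1} - r l / n| +
      2 * (∑ l, (r l : ℝ)) ^ 2 / n) atTop (𝓝 0) := by
    simpa only [Finset.sum_const_zero, add_zero] using (htwo.add
      (tendsto_finsetSum Finset.univ fun l _ => hone l)).add
      (tendsto_const_div_atTop_nhds_zero_nat (2 * (∑ l, (r l : ℝ)) ^ 2))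
  refine squeeze_zero' (Eventually.of_forall fun n => norm_nonneg _) ?_ hbound
  filter_upwards [eventually_gt_atTop 0] with n hn
  have hn' : (n : ℝ) ≠ 0 := Nat.cast_ne_zero.2 hn.ne'
  have hsum : ∑ _j : Fin n, (fun l => r l / (n : ℝ≥0)) = r := by
    ext l
    simp only [Finset.sum_apply, Finset.sum_const, Finset.card_univ, Fintype.card_fin,
      nsmul_eq_mul, NNReal.coe_mul, NNReal.coe_div, NNReal.coe_natCast]
    exact mul_div_cancel₀ _ hn'
  have h := abs_measureReal_sum_sub_poissonPi_le (hX n) (hind n)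
    (fun _ l => r l / (n : ℝ≥0)) Finset.univ A
  rw [hsum] at h
  refine h.trans_eq ?_
  simp only [NNReal.coe_div, NNReal.coe_natCast, Finset.sum_add_distrib, ← Finset.sum_div,
    Finset.sum_const, Finset.card_univ, Fintype.card_fin, nsmul_eq_mul]
  rw [Finset.sum_comm]
  congr 1
  field_simp

section Increments

variable {m : ℕ} {v : Fin (m + 1) → ℕ}

lemma sum_increments (hv : Monotone v) :
    ∑ l : Fin m, (v l.succ - v l.castSucc) = v (Fin.last m) - v 0 := by
  induction m with
  | zero => simp
  | succ m ih =>
    have hinit := ih (hv.comp Fin.strictMono_castSucc.monotone)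
    have hle : v 0 ≤ v (Fin.last m).castSucc := hv (Fin.zero_le _)
    have hle' : v (Fin.last m).castSucc ≤ v (Fin.last (m + 1)) := hv (Fin.le_last _)
    simp only [Function.comp_apply, Fin.castSucc_zero, ← Fin.succ_castSucc] at hinit
    rw [Fin.sum_univ_castSucc, hinit, Fin.succ_last, add_comm, tsub_add_tsub_cancel hle' hle]

lemma increments_eq_single_iff (hv : Monotone v) (hlast : v (Fin.last m) < 2) (l : Fin m) :
    (fun i : Fin m => v i.succ - v i.castSucc) = Pi.single l 1 ↔
      1 ≤ v l.succ ∧ ¬ 1 ≤ v l.castSucc := by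
  have hle (i : Fin m) : v i.succ < 2 := (hv (Fin.le_last _)).trans_lt hlast
  constructor
  · intro h
    have hl : v l.succ - v l.castSucc = 1 := by simpa using congrFun h l
    have := hle l
    omega
  · intro h
    ext i
    have := hle i
    rcases lt_trichotomy i l with hil | rfl | hil
    · have : v i.succ ≤ v l.castSucc := hv (Fin.succ_le_castSucc_iff.2 hil)
      rw [Pi.single_eq_of_ne hil.ne]
      omega
    · rw [Pi.single_eq_same]
      omega
    · have : v l.succ ≤ v i.castSucc := hv (Fin.succ_le_castSucc_iff.2 hil)
      rw [Pi.single_eq_of_ne hil.ne']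
      omega

lemma abs_measureReal_increments_eq_single_sub_le {Ω : Type*} [MeasurableSpace Ω]
    {P : Measure Ω} [IsFiniteMeasure P] {V : Ω → Fin (m + 1) → ℕ} (hV : Measurable V)
    (hmono : ∀ᵐ ω ∂P, Monotone (V ω)) (l : Fin m) :
    |P.real {ω | (fun i : Fin m => V ω i.succ - V ω i.castSucc) = Pi.single l 1} -
        (P.real {ω | 1 ≤ V ω l.succ} - P.real {ω | 1 ≤ V ω l.castSucc})| ≤
      P.real {ω | 2 ≤ V ω (Fin.last m)} := by
  have hmeas (p : (Fin (m + 1) → ℕ) → Prop) : MeasurableSet {ω | p (V ω)} :=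
    hV (.of_discrete (s := {v | p v}))
  have hdiff : P.real {ω | 1 ≤ V ω l.succ} - P.real {ω | 1 ≤ V ω l.castSucc} =
      P.real {ω | 1 ≤ V ω l.succ ∧ ¬ 1 ≤ V ω l.castSucc} := by
    rw [← measureReal_inter_add_sdiff (s := {ω | 1 ≤ V ω l.succ})
      (hmeas fun v => 1 ≤ v l.castSucc)]
    have hinter : P.real ({ω | 1 ≤ V ω l.succ} ∩ {ω | 1 ≤ V ω l.castSucc}) =
        P.real {ω | 1 ≤ V ω l.castSucc} := by
      refine measureReal_congr ?_
      filter_upwards [hmono] with ω hω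
      exact propext ⟨And.right, fun h => ⟨le_trans h (hω l.castSucc_lt_succ.le), h⟩⟩
    rw [hinter, add_sub_cancel_left]
    rfl
  rw [hdiff]
  refine (abs_measureReal_sub_le_measureReal_symmDiff
    (hmeas fun v => (fun i : Fin m => v i.succ - v i.castSucc) = Pi.single l 1).nullMeasurableSet
    (hmeas fun v => 1 ≤ v l.succ ∧ ¬ 1 ≤ v l.castSucc).nullMeasurableSet).trans ?_
  refine ENNReal.toReal_mono (measure_ne_top _ _) (measure_mono_ae ?_)
  filter_upwards [hmono] with ω hω hsymm
  by_contra hlast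
  have hiff := increments_eq_single_iff hω (not_le.1 hlast) l
  rcases hsymm with h | h
  · exact h.2 (hiff.1 h.1)
  · exact h.2 (hiff.2 h.1)

end Increments

theorem tendsto_measure_sum_increments_mem_poissonPi {Ω : ℕ → Type*}
    [∀ n, MeasurableSpace (Ω n)] {P : ∀ n, Measure (Ω n)} [∀ n, IsProbabilityMeasure (P n)] {m : ℕ}
    {V : ∀ n, Fin n → Ω n → Fin (m + 1) → ℕ} (hV : ∀ n j, Measurable (V n j))
    (hind : ∀ n, iIndepFun (V n) (P n)) (hmono : ∀ n, ∀ᵐ ω ∂P n, ∀ j, Monotone (V n j ω))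
    {r : Fin (m + 1) → ℝ≥0} (hr : Monotone r)
    (hone : ∀ l, Tendsto (fun n : ℕ => ∑ j, |(P n).real {ω | 1 ≤ V n j ω l} - r l / n|)
      atTop (𝓝 0))
    (htwo : Tendsto (fun n => ∑ j, (P n).real {ω | 2 ≤ V n j ω (Fin.last m)}) atTop (𝓝 0))
    (A : Set (Fin m → ℕ)) :
    Tendsto (fun n => P n {ω |
        (fun l : Fin m => ∑ j, V n j ω l.succ - ∑ j, V n j ω l.castSucc) ∈ A})
      atTop (𝓝 (poissonPi (fun l : Fin m => r l.succ - r l.castSucc) A)) := by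
  let X (n : ℕ) (j : Fin n) (ω : Ω n) (l : Fin m) : ℕ := V n j ω l.succ - V n j ω l.castSucc
  have hmono' (n : ℕ) : ∀ j, ∀ᵐ ω ∂P n, Monotone (V n j ω) := ae_all_iff.1 (hmono n)
  have htriangle {p a b c d e : ℝ} (h : |p - (a - b)| ≤ e) :
      |p - (c - d)| ≤ e + |a - c| + |b - d| := by
    calc |p - (c - d)| = |p - (a - b) + (a - c) - (b - d)| := by ring_nf
      _ ≤ |p - (a - b)| + |a - c| + |b - d| :=
          (abs_sub _ _).trans (add_le_add_left (abs_add_le _ _) _)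
      _ ≤ e + |a - c| + |b - d| := by gcongr
  have hincr : Measurable fun (v : Fin (m + 1) → ℕ) (l : Fin m) => v l.succ - v l.castSucc :=
    .of_discrete
  have hlim := tendsto_measure_sum_mem_poissonPi (X := X) (fun n j => hincr.comp (hV n j))
    (fun n => (hind n).comp _ fun _ => hincr) (fun l => r l.succ - r l.castSucc) ?_ ?_ A
  · refine hlim.congr fun n => measure_congr ?_
    filter_upwards [hmono n] with ω hω
    refine congrArg (· ∈ A) (funext fun l => ?_)
    rw [Finset.sum_apply]
    exact Finset.sum_tsub_distrib _ fun j _ => hω j l.castSucc_lt_succ.le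
  · intro l
    refine squeeze_zero (fun n => Finset.sum_nonneg fun _ _ => abs_nonneg _) (fun n => ?_)
      (by simpa only [add_zero] using (htwo.add (hone l.succ)).add (hone l.castSucc))
    simp only [← Finset.sum_add_distrib]
    refine Finset.sum_le_sum fun j _ => ?_
    rw [NNReal.coe_sub (hr l.castSucc_lt_succ.le), sub_div]
    exact htriangle (abs_measureReal_increments_eq_single_sub_le (hV n j) (hmono' n j) l)
  · refine squeeze_zero (fun n => Finset.sum_nonneg fun _ _ => measureReal_nonneg)
      (fun n => ?_) htwo
    refine Finset.sum_le_sum fun j _ =>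
      ENNReal.toReal_mono (measure_ne_top _ _) (measure_mono_ae ?_)
    filter_upwards [hmono' n j] with ω hω hsum
    have hsum' : 2 ≤ V n j ω (Fin.last m) - V n j ω 0 := sum_increments hω ▸ hsum
    exact hsum'.trans (Nat.sub_le _ _)

end PoissonApproximation

section ConvergenceInDistribution

variable {α : Type*} {F : Filter α} {Ω : α → Type*} [∀ a, MeasurableSpace (Ω a)]
  {P : ∀ a, Measure (Ω a)} {Ω' : Type*} [MeasurableSpace Ω'] {P' : Measure Ω'}

section Criteria

variable [F.IsCountablyGenerated] [∀ a, IsProbabilityMeasure (P a)] [IsProbabilityMeasure P']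

theorem tendstoInDistribution_of_isPiSystem {E : Type*} [MeasurableSpace E] [TopologicalSpace E]
    [SecondCountableTopology E] [OpensMeasurableSpace E] {S : Set (Set E)} (hS : IsPiSystem S)
    (hmeas : ∀ s ∈ S, MeasurableSet s)
    (hnhds : ∀ u : Set E, IsOpen u → ∀ x ∈ u, ∃ s ∈ S, s ∈ 𝓝 x ∧ s ⊆ u)
    {X : ∀ a, Ω a → E} (hX : ∀ a, AEMeasurable (X a) (P a)) {Y : Ω' → E} (hY : AEMeasurable Y P')
    (h : ∀ s ∈ S, Tendsto (fun a => P a (X a ⁻¹' s)) F (𝓝 (P' (Y ⁻¹' s)))) :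
    TendstoInDistribution X F Y P P' where
  forall_aemeasurable := hX
  aemeasurable_limit := hY
  tendsto := by
    refine hS.tendsto_probabilityMeasure_of_tendsto_of_mem hmeas hnhds fun s hs => ?_
    have hlim : Tendsto (fun a => (P a).map (X a) s) F (𝓝 (P'.map Y s)) := by
      simpa only [Measure.map_apply_of_aemeasurable (hX _) (hmeas s hs),
        Measure.map_apply_of_aemeasurable hY (hmeas s hs)] using h s hs
    have : IsProbabilityMeasure (P'.map Y) := Measure.isProbabilityMeasure_map hY
    have hfin : P'.map Y s ≠ ∞ := measure_ne_top _ _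
    exact (ENNReal.tendsto_toNNReal hfin).comp hlim

lemma exists_Ioc_mem_nhds_subset {u : Set ℝ} {x : ℝ} (hu : u ∈ 𝓝 x) :
    ∃ a b, Set.Ioc a b ∈ 𝓝 x ∧ Set.Ioc a b ⊆ u := by
  obtain ⟨a, b, hx, hab⟩ := mem_nhds_iff_exists_Ioo_subset.1 hu
  obtain ⟨c, hxc, hcb⟩ := exists_between hx.2
  exact ⟨a, c, Ioc_mem_nhds hx.1 hxc, (Set.Ioc_subset_Ioo_right hcb).trans hab⟩

lemma measure_preimage_Ioc_eq_sub {Ω : Type*} [MeasurableSpace Ω] {P : Measure Ω}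
    [IsFiniteMeasure P] {X : Ω → ℝ} (hX : AEMeasurable X P) {a b : ℝ} (hab : a ≤ b) :
    P (X ⁻¹' Set.Ioc a b) = P {ω | X ω ≤ b} - P {ω | X ω ≤ a} := by
  have hsub : {ω | X ω ≤ a} ⊆ {ω | X ω ≤ b} := fun ω hω => le_trans hω hab
  rw [← measure_sdiff hsub (hX.nullMeasurable measurableSet_Iic) (measure_ne_top _ _),
    ← Set.Iic_sdiff_Iic, Set.preimage_sdiff]
  rfl

theorem tendstoInDistribution_of_tendsto_le {X : ∀ a, Ω a → ℝ}
    (hX : ∀ a, AEMeasurable (X a) (P a)) {Y : Ω' → ℝ} (hY : AEMeasurable Y P')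
    (h : ∀ c, Tendsto (fun a => P a {ω | X a ω ≤ c}) F (𝓝 (P' {ω | Y ω ≤ c}))) :
    TendstoInDistribution X F Y P P' := by
  refine tendstoInDistribution_of_isPiSystem (S := {s | ∃ a b : ℝ, s = Set.Ioc a b}) ?_ ?_ ?_
    hX hY ?_
  · rintro _ ⟨a, b, rfl⟩ _ ⟨a', b', rfl⟩ -
    exact ⟨a ⊔ a', b ⊓ b', Set.Ioc_inter_Ioc⟩
  · rintro _ ⟨a, b, rfl⟩
    exact measurableSet_Ioc
  · intro u hu x hx
    obtain ⟨a, b, hab⟩ := exists_Ioc_mem_nhds_subset (hu.mem_nhds hx)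
    exact ⟨_, ⟨a, b, rfl⟩, hab⟩
  · rintro _ ⟨a, b, rfl⟩
    rcases le_or_gt b a with hba | hab
    · simpa only [Set.Ioc_eq_empty_of_le hba, Set.preimage_empty, measure_empty]
        using tendsto_const_nhds
    · simp only [measure_preimage_Ioc_eq_sub (hX _) hab.le, measure_preimage_Ioc_eq_sub hY hab.le]
      exact ENNReal.Tendsto.sub (h b) (h a) (Or.inl (measure_ne_top _ _))

theorem tendstoInDistribution_pi_of_tendsto_Ioc {ι : Type*} [Finite ι] {X : ∀ a, Ω a → ι → ℝ}
    (hX : ∀ a, AEMeasurable (X a) (P a)) {Y : Ω' → ι → ℝ} (hY : AEMeasurable Y P')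
    (h : ∀ b c : ι → ℝ, Tendsto (fun a => P a {ω | ∀ i, X a ω i ∈ Set.Ioc (b i) (c i)}) F
      (𝓝 (P' {ω | ∀ i, Y ω i ∈ Set.Ioc (b i) (c i)}))) :
    TendstoInDistribution X F Y P P' := by
  refine tendstoInDistribution_of_isPiSystem
    (S := {s | ∃ b c : ι → ℝ, s = Set.univ.pi fun i => Set.Ioc (b i) (c i)}) ?_ ?_ ?_ hX hY ?_
  · rintro _ ⟨b, c, rfl⟩ _ ⟨b', c', rfl⟩ -
    refine ⟨b ⊔ b', c ⊓ c', ?_⟩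
    simp only [← Set.pi_inter_distrib, Set.Ioc_inter_Ioc, Pi.sup_apply, Pi.inf_apply]
  · rintro _ ⟨b, c, rfl⟩
    exact MeasurableSet.univ_pi fun i => measurableSet_Ioc
  · intro u hu x hx
    rw [isOpen_pi_iff'] at hu
    obtain ⟨v, hv, hvu⟩ := hu x hx
    choose b c hnhds hsub using fun i => exists_Ioc_mem_nhds_subset ((hv i).1.mem_nhds (hv i).2)
    exact ⟨_, ⟨b, c, rfl⟩, set_pi_mem_nhds Set.finite_univ fun i _ => hnhds i,
      (Set.pi_mono fun i _ => hsub i).trans hvu⟩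
  · rintro _ ⟨b, c, rfl⟩
    simpa only [Set.preimage, Set.mem_univ_pi] using h b c

end Criteria

lemma exists_restrict_eq_comp_increments (s : Finset ℝ≥0) :
    ∃ (m : ℕ) (t : Fin (m + 1) → ℝ≥0) (g : (Fin m → ℕ) → s → ℕ), Monotone t ∧ t 0 = 0 ∧
      ∀ x : ℝ≥0 → ℕ, Monotone x → x 0 = 0 →
        s.restrict x = g fun l => x (t l.succ) - x (t l.castSucc) := by
  obtain ⟨m, hm⟩ : ∃ m, (insert 0 s).card = m + 1 :=
    Nat.exists_eq_add_one.2 (Finset.insert_nonempty 0 s).card_pos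
  let t : Fin (m + 1) ↪o ℝ≥0 := (insert 0 s).orderEmbOfFin hm
  have ht0 : t 0 = 0 :=
    le_antisymm (((insert 0 s).orderEmbOfFin_zero hm m.succ_pos).trans_le
      (Finset.min'_le _ _ (Finset.mem_insert_self 0 s))) zero_le
  have hmem (u : s) : ∃ l, t l = u := by
    have hu : (u : ℝ≥0) ∈ Set.range t := by
      rw [Finset.range_orderEmbOfFin]
      exact Finset.mem_coe.2 (Finset.mem_insert_of_mem u.2)
    exact hu
  choose l hl using hmem
  refine ⟨m, t, fun d u => Fin.partialSum d (l u), t.monotone, ht0, fun x hx hx0 => ?_⟩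
  have hsum (k : Fin (m + 1)) :
      Fin.partialSum (fun l : Fin m => x (t l.succ) - x (t l.castSucc)) k = x (t k) := by
    induction k using Fin.induction with
    | zero => rw [Fin.partialSum_zero, ht0, hx0]
    | succ k ih =>
      rw [Fin.partialSum_succ, ih, add_tsub_cancel_of_le (hx (t.monotone k.castSucc_lt_succ.le))]
  ext u
  simp only [Finset.restrict, hsum, hl]

theorem tendsto_measure_restrict_of_tendsto_increments
    {X : ∀ a, ℝ≥0 → Ω a → ℕ} {Y : ℝ≥0 → Ω' → ℕ}
    (hX0 : ∀ a, ∀ᵐ ω ∂P a, X a 0 ω = 0) (hX : ∀ a, ∀ᵐ ω ∂P a, Monotone fun t => X a t ω)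
    (hY0 : ∀ᵐ ω ∂P', Y 0 ω = 0) (hY : ∀ᵐ ω ∂P', Monotone fun t => Y t ω)
    (h : ∀ (m : ℕ) (t : Fin (m + 1) → ℝ≥0), Monotone t → t 0 = 0 → ∀ A : Set (Fin m → ℕ),
      Tendsto (fun a => P a {ω | (fun l => X a (t l.succ) ω - X a (t l.castSucc) ω) ∈ A}) F
        (𝓝 (P' {ω | (fun l => Y (t l.succ) ω - Y (t l.castSucc) ω) ∈ A})))
    (s : Finset ℝ≥0) (A : Set (s → ℕ)) :
    Tendsto (fun a => P a {ω | s.restrict (fun t => X a t ω) ∈ A}) F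
      (𝓝 (P' {ω | s.restrict (fun t => Y t ω) ∈ A})) := by
  obtain ⟨m, t, g, ht, ht0, hg⟩ := exists_restrict_eq_comp_increments s
  have hY' : P' {ω | s.restrict (fun t => Y t ω) ∈ A} =
      P' {ω | (fun l => Y (t l.succ) ω - Y (t l.castSucc) ω) ∈ g ⁻¹' A} := by
    refine measure_congr ?_
    filter_upwards [hY0, hY] with ω h0 hmono
    exact congrArg (· ∈ A) (hg (fun t => Y t ω) hmono h0)
  rw [hY']
  refine (h m t ht ht0 (g ⁻¹' A)).congr fun a => measure_congr ?_
  filter_upwards [hX0 a, hX a] with ω h0 hmono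
  exact congrArg (· ∈ A) (hg (fun t => X a t ω) hmono h0).symm

theorem tendstoInDistribution_hittingTimes [F.IsCountablyGenerated]
    [∀ a, IsProbabilityMeasure (P a)] [IsProbabilityMeasure P'] {ι : Type*} [Finite ι] {κ : ι → ℕ}
    {X : ∀ a, ℝ≥0 → Ω a → ℕ} {Y : ℝ≥0 → Ω' → ℕ}
    (h : ∀ (s : Finset ℝ≥0) (A : Set (s → ℕ)),
      Tendsto (fun a => P a {ω | s.restrict (fun t => X a t ω) ∈ A}) F
        (𝓝 (P' {ω | s.restrict (fun t => Y t ω) ∈ A})))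
    {τ : ∀ a, Ω a → ι → ℝ} (hτ : ∀ a, AEMeasurable (τ a) (P a))
    {τ' : Ω' → ι → ℝ} (hτ' : AEMeasurable τ' P')
    (hX : ∀ᶠ a in F, ∀ᵐ ω ∂P a, ∀ i c, τ a ω i ≤ c ↔ κ i ≤ X a c.toNNReal ω)
    (hY : ∀ᵐ ω ∂P', ∀ i c, τ' ω i ≤ c ↔ κ i ≤ Y c.toNNReal ω) :
    TendstoInDistribution τ F τ' P P' := by
  classical
  have := Fintype.ofFinite ι
  refine tendstoInDistribution_pi_of_tendsto_Ioc hτ hτ' fun b c => ?_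
  let s : Finset ℝ≥0 :=
    Finset.univ.image (fun i => (b i).toNNReal) ∪ Finset.univ.image fun i => (c i).toNNReal
  have hb (i : ι) : (b i).toNNReal ∈ s := by simp [s]
  have hc (i : ι) : (c i).toNNReal ∈ s := by simp [s]
  let A : Set (s → ℕ) := {x | ∀ i, ¬ κ i ≤ x ⟨_, hb i⟩ ∧ κ i ≤ x ⟨_, hc i⟩}
  have hA (x : ℝ≥0 → ℕ) (u : ι → ℝ) (hu : ∀ i c, u i ≤ c ↔ κ i ≤ x c.toNNReal) :
      s.restrict x ∈ A ↔ ∀ i, u i ∈ Set.Ioc (b i) (c i) := by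
    simp only [A, Set.mem_ofPred_eq, Finset.restrict, Set.mem_Ioc, ← not_le, hu]
  have hlim : P' {ω | ∀ i, τ' ω i ∈ Set.Ioc (b i) (c i)} =
      P' {ω | s.restrict (fun t => Y t ω) ∈ A} := by
    refine measure_congr ?_
    filter_upwards [hY] with ω hω
    exact propext (hA (fun t => Y t ω) (τ' ω) hω).symm
  rw [hlim]
  refine (h s A).congr' ?_
  filter_upwards [hX] with a ha
  refine measure_congr ?_
  filter_upwards [ha] with ω hω
  exact propext (hA (fun t => X a t ω) (τ a ω) hω)

end ConvergenceInDistribution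

lemma csInf_le_iff_mem {α : Type*} [ConditionallyCompleteLinearOrder α] {A : Set α}
    (hb : BddBelow A) (hne : A.Nonempty) (hup : IsUpperSet A)
    (hright : ∀ t, (∀ s, t < s → s ∈ A) → t ∈ A) {c : α} : sInf A ≤ c ↔ c ∈ A := by
  refine ⟨fun h => hright c fun s hs => ?_, fun h => csInf_le hb h⟩
  obtain ⟨a, ha, has⟩ := (csInf_lt_iff hb hne).1 (h.trans_lt hs)
  exact hup has.le ha

lemma csInf_setOf_le_le_iff {α β : Type*} [ConditionallyCompleteLinearOrderBot α]
    [TopologicalSpace α] [OrderTopology α] [DenselyOrdered α] [NoMaxOrder α] [Preorder β]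
    [TopologicalSpace β] [ClosedIciTopology β] {f : α → β} (hmono : Monotone f)
    (hright : ∀ t, ContinuousWithinAt f (Set.Ioi t) t) {k : β} (hne : ∃ t, k ≤ f t) {c : α} :
    sInf {t | k ≤ f t} ≤ c ↔ k ≤ f c :=
  csInf_le_iff_mem (OrderBot.bddBelow _) hne (fun _ _ hst hs => le_trans hs (hmono hst))
    fun t ht => ge_of_tendsto (hright t) (eventually_mem_nhdsWithin.mono ht)

lemma aemeasurable_of_nullMeasurableSet_le {Ω α : Type*} [MeasurableSpace Ω] {P : Measure Ω}
    [TopologicalSpace α] [SecondCountableTopology α] [LinearOrder α] [OrderTopology α]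
    [MeasurableSpace α] [BorelSpace α] {f : Ω → α}
    (h : ∀ c, NullMeasurableSet {ω | f ω ≤ c} P) : AEMeasurable f P :=
  NullMeasurable.aemeasurable fun s hs =>
    @measurable_of_Iic α (NullMeasurableSpace Ω P) _ _ _ _ _ _ _ f h s hs

section PoissonGamma

lemma poissonMeasure_real_Iio (r : ℝ≥0) (k : ℕ) :
    (poissonMeasure r).real (Set.Iio k) =
      ∑ i ∈ Finset.range k, Real.exp (-(r : ℝ)) * (r : ℝ) ^ i / i.factorial := by
  rw [← Finset.coe_Iio, Nat.Iio_eq_range, ← sum_measureReal_singleton]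
  simp only [poissonMeasure_real_singleton]

lemma hasDerivAt_sum_exp_neg_mul_pow_div_factorial (k : ℕ) (x : ℝ) :
    HasDerivAt (fun x : ℝ => ∑ i ∈ Finset.range (k + 1), Real.exp (-x) * x ^ i / i.factorial)
      (-(Real.exp (-x) * x ^ k / k.factorial)) x := by
  have hexp : HasDerivAt (fun x : ℝ => Real.exp (-x)) (-Real.exp (-x)) x := by
    simpa only [mul_neg, mul_one] using (hasDerivAt_neg x).exp
  induction k with
  | zero => simpa using! hexp
  | succ k ih =>
    have h := ih.add ((hexp.mul (hasDerivAt_pow (k + 1) x)).div_const ((k + 1).factorial : ℝ))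
    simp only [Finset.sum_range_succ _ (k + 1)]
    refine h.congr_deriv ?_
    have hk : (k.factorial : ℝ) ≠ 0 := by positivity
    rw [Nat.factorial_succ, add_tsub_cancel_right]
    push_cast
    field_simp
    ring

lemma intervalIntegral_exp_neg_mul_pow_div_factorial (k : ℕ) (c : ℝ) :
    ∫ x in (0 : ℝ)..c, Real.exp (-x) * x ^ k / k.factorial =
      1 - ∑ i ∈ Finset.range (k + 1), Real.exp (-c) * c ^ i / i.factorial := by
  have hzero : ∑ i ∈ Finset.range (k + 1), Real.exp (-0) * (0 : ℝ) ^ i / i.factorial = 1 := by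
    rw [Finset.sum_range_succ', Finset.sum_eq_zero fun i _ => by simp]
    simp
  rw [intervalIntegral.integral_eq_sub_of_hasDerivAt
    (fun x _ => (hasDerivAt_sum_exp_neg_mul_pow_div_factorial k x).fun_neg.congr_deriv (neg_neg _))
    (Continuous.intervalIntegrable (by fun_prop) _ _), hzero]
  ring

lemma gammaPDFReal_natCast_add_one (k : ℕ) :
    gammaPDFReal (k + 1) 1 =
      Set.indicator (Set.Ici 0) fun x => Real.exp (-x) * x ^ k / k.factorial := by
  ext x
  simp only [gammaPDFReal, Set.indicator_apply, Set.mem_Ici]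
  split_ifs
  · rw [Real.Gamma_nat_eq_factorial, Real.one_rpow, add_sub_cancel_right, Real.rpow_natCast,
      one_mul]
    ring
  · rfl

lemma gammaMeasure_real_Iic (k : ℕ) (c : ℝ≥0) :
    (gammaMeasure (k + 1) 1).real (Set.Iic (c : ℝ)) =
      ∫ x in (0 : ℝ)..c, Real.exp (-x) * x ^ k / k.factorial := by
  have hk : (0 : ℝ) < k + 1 := by positivity
  have := isProbabilityMeasure_gammaMeasure hk one_pos
  rw [← cdf_eq_real, cdf_gammaMeasure_eq_integral hk one_pos, gammaPDFReal_natCast_add_one,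
    setIntegral_indicator measurableSet_Ici, Set.inter_comm, Set.Ici_inter_Iic,
    integral_Icc_eq_integral_Ioc, intervalIntegral.integral_of_le c.coe_nonneg]

lemma gammaMeasure_Iic_toNNReal {a r : ℝ} (c : ℝ) :
    gammaMeasure a r (Set.Iic (c.toNNReal : ℝ)) = gammaMeasure a r (Set.Iic c) := by
  rcases le_or_gt 0 c with hc | hc
  · rw [Real.coe_toNNReal c hc]
  · have hzero : gammaMeasure a r (Set.Iic 0) = 0 := by
      rw [gammaMeasure, withDensity_apply _ measurableSet_Iic,
        setLIntegral_congr Iio_ae_eq_Iic.symm, lintegral_gammaPDF_of_nonpos le_rfl]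
    rw [Real.toNNReal_of_nonpos hc.le, NNReal.coe_zero, hzero,
      measure_mono_null (Set.Iic_subset_Iic.2 hc.le) hzero]

theorem poissonMeasure_Ici_eq_gammaMeasure_Iic {k : ℕ} (hk : 0 < k) (c : ℝ) :
    poissonMeasure c.toNNReal (Set.Ici k) = gammaMeasure k 1 (Set.Iic c) := by
  have := isProbabilityMeasure_gammaMeasure (Nat.cast_pos.2 hk : (0 : ℝ) < k) one_pos
  obtain ⟨k, rfl⟩ := Nat.exists_eq_add_one.2 hk
  rw [← gammaMeasure_Iic_toNNReal]
  refine (measureReal_eq_measureReal_iff).1 ?_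
  rw [← Set.compl_Iio, probReal_compl_eq_one_sub .of_discrete, poissonMeasure_real_Iio,
    Nat.cast_add_one, gammaMeasure_real_Iic, intervalIntegral_exp_neg_mul_pow_div_factorial]

theorem tendsto_poissonMeasure_Iio (k : ℕ) :
    Tendsto (fun r => poissonMeasure r (Set.Iio k)) atTop (𝓝 0) := by
  have hreal : Tendsto (fun r => (poissonMeasure r).real (Set.Iio k)) atTop (𝓝 0) := by
    simp only [poissonMeasure_real_Iio]
    rw [← Finset.sum_const_zero (ι := ℕ) (s := Finset.range k)]
    refine tendsto_finsetSum _ fun i _ => ?_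
    have h := ((Real.tendsto_pow_mul_exp_neg_atTop_nhds_zero i).comp
      (NNReal.tendsto_coe_atTop.2 tendsto_id)).div_const (i.factorial : ℝ)
    simpa only [Function.comp_def, zero_div, mul_comm, id] using h
  exact (ENNReal.tendsto_toReal_zero_iff fun _ => measure_ne_top _ _).1 hreal

end PoissonGamma

section TruncatedGeometric

/-- The geometric distribution truncated to `{0, …, j}`, with mass proportional to `q ^ l`
at `l`. The parameter `1 ≤ q` is allowed. -/
noncomputable def truncatedGeometric (j : ℕ) (q : ℝ≥0) : Measure ℕ :=
  ∑ l ∈ Finset.range (j + 1),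
    ((q ^ l / ∑ i ∈ Finset.range (j + 1), q ^ i : ℝ≥0) : ℝ≥0∞) • Measure.dirac l

variable (j : ℕ) (q : ℝ≥0)

lemma truncatedGeometric_apply (A : Set ℕ) [DecidablePred (· ∈ A)] :
    truncatedGeometric j q A = (((∑ l ∈ Finset.range (j + 1) with l ∈ A, q ^ l) /
      ∑ l ∈ Finset.range (j + 1), q ^ l : ℝ≥0) : ℝ≥0∞) := by
  rw [truncatedGeometric, Measure.finsetSum_apply, Finset.sum_filter, Finset.sum_div,
    ENNReal.ofNNReal_finsetSum]
  refine Finset.sum_congr rfl fun l _ => ?_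
  rw [Measure.smul_apply, Measure.dirac_apply, Set.indicator_apply]
  split_ifs <;> simp

instance truncatedGeometric.isProbabilityMeasure :
    IsProbabilityMeasure (truncatedGeometric j q) where
  measure_univ := by
    have hpos : 0 < ∑ l ∈ Finset.range (j + 1), q ^ l := geom_sum_pos zero_le j.succ_ne_zero
    rw [truncatedGeometric_apply, Finset.filter_true_of_mem fun _ _ => Set.mem_univ _,
      div_self hpos.ne', ENNReal.coe_one]

lemma truncatedGeometric_real (A : Set ℕ) [DecidablePred (· ∈ A)] :
    (truncatedGeometric j q).real A = (∑ l ∈ Finset.range (j + 1) with l ∈ A, (q : ℝ) ^ l) /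
      ∑ l ∈ Finset.range (j + 1), (q : ℝ) ^ l := by
  rw [measureReal_def, truncatedGeometric_apply, ENNReal.coe_toReal]
  push_cast
  rfl

lemma truncatedGeometric_singleton (l : ℕ) : truncatedGeometric j q {l} =
    if l ≤ j then ((q ^ l / ∑ i ∈ Finset.range (j + 1), q ^ i : ℝ≥0) : ℝ≥0∞) else 0 := by
  simp only [truncatedGeometric_apply, Set.mem_singleton_iff, Finset.filter_eq',
    Finset.mem_range, Nat.lt_succ_iff]
  split_ifs <;> simp

lemma truncatedGeometric_real_Ici_le (a : ℕ) :
    (truncatedGeometric j q).real (Set.Ici a) ≤ (q : ℝ) ^ a := by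
  rw [truncatedGeometric_real, div_le_iff₀ (geom_sum_pos q.coe_nonneg j.succ_ne_zero)]
  calc ∑ l ∈ Finset.range (j + 1) with l ∈ Set.Ici a, (q : ℝ) ^ l
      = ∑ l ∈ Finset.Ico a (j + 1), (q : ℝ) ^ l := by
        congr 1
        ext l
        simp [and_comm]
    _ = (q : ℝ) ^ a * ∑ l ∈ Finset.range (j + 1 - a), (q : ℝ) ^ l := by
        rw [Finset.sum_Ico_eq_sum_range, Finset.mul_sum]
        simp only [pow_add]
    _ ≤ (q : ℝ) ^ a * ∑ l ∈ Finset.range (j + 1), (q : ℝ) ^ l := by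
        gcongr
        exact tsub_le_self

lemma sub_sq_le_truncatedGeometric_real_Ici_one {j : ℕ} (hj : j ≠ 0) :
    (q : ℝ) - q ^ 2 ≤ (truncatedGeometric j q).real (Set.Ici 1) := by
  have hq : (0 : ℝ) ≤ q := q.coe_nonneg
  have hsum : 1 + (q : ℝ) ≤ ∑ l ∈ Finset.range (j + 1), (q : ℝ) ^ l := by
    calc 1 + (q : ℝ) = ∑ l ∈ Finset.range 2, (q : ℝ) ^ l := by simp [Finset.sum_range_succ]
      _ ≤ _ := by
        gcongr
        omega
  have hzero : (truncatedGeometric j q).real {0} ≤ 1 / (1 + q) := by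
    rw [measureReal_def, truncatedGeometric_singleton, if_pos zero_le, ENNReal.coe_toReal]
    push_cast
    rw [pow_zero]
    gcongr
  have hinv : 1 / (1 + (q : ℝ)) ≤ 1 - q + q ^ 2 := by
    rw [div_le_iff₀ (by positivity)]
    nlinarith only [pow_nonneg hq 3]
  have hcompl : Set.Ici 1 = ({0} : Set ℕ)ᶜ := by
    ext l
    simp [Nat.one_le_iff_ne_zero]
  rw [hcompl, probReal_compl_eq_one_sub .of_discrete]
  linarith

lemma truncatedGeometric_real_Iio_le {q : ℝ≥0} (hq : 0 < q) :
    (truncatedGeometric j q).real (Set.Iio j) ≤ 1 / (q : ℝ) := by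
  have hfilter : (Finset.range (j + 1)).filter (· ∈ Set.Iio j) = Finset.range j := by
    ext l
    simp only [Finset.mem_filter, Finset.mem_range, Set.mem_Iio]
    omega
  rw [truncatedGeometric_real, hfilter,
    div_le_div_iff₀ (geom_sum_pos q.coe_nonneg j.succ_ne_zero) (NNReal.coe_pos.2 hq), geom_sum_succ]
  linarith

end TruncatedGeometric

section TruncatedGeometricLimits

lemma tendsto_sum_abs_truncatedGeometric_real_Ici_one_sub (x : ℝ≥0) :
    Tendsto (fun n : ℕ => ∑ j : Fin n,
      |(truncatedGeometric j (x / n)).real (Set.Ici 1) - (x : ℝ) / n|) atTop (𝓝 0) := by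
  have hterm (j : ℕ) (q : ℝ≥0) : |(truncatedGeometric j q).real (Set.Ici 1) - (q : ℝ)| ≤
      (if j = 0 then (q : ℝ) else 0) + q ^ 2 := by
    have hupper := truncatedGeometric_real_Ici_le j q 1
    have hnonneg : 0 ≤ (truncatedGeometric j q).real (Set.Ici 1) := measureReal_nonneg
    rw [pow_one] at hupper
    rw [abs_sub_comm, abs_of_nonneg (sub_nonneg.2 hupper)]
    split_ifs with hj
    · linarith [sq_nonneg (q : ℝ)]
    · linarith [sub_sq_le_truncatedGeometric_real_Ici_one q hj]
  have hlim : Tendsto (fun n : ℕ => (x : ℝ) / n + (x : ℝ) ^ 2 / n) atTop (𝓝 0) := by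
    simpa only [add_zero] using (tendsto_const_div_atTop_nhds_zero_nat (x : ℝ)).add
      (tendsto_const_div_atTop_nhds_zero_nat ((x : ℝ) ^ 2))
  refine squeeze_zero' (Eventually.of_forall fun n => Finset.sum_nonneg fun _ _ => abs_nonneg _)
    ?_ hlim
  filter_upwards [eventually_gt_atTop 0] with n hn
  have hn' : (n : ℝ) ≠ 0 := Nat.cast_ne_zero.2 hn.ne'
  calc ∑ j : Fin n, |(truncatedGeometric j (x / n)).real (Set.Ici 1) - (x : ℝ) / n|
      ≤ ∑ j : Fin n, ((if (j : ℕ) = 0 then (x : ℝ) / n else 0) + ((x : ℝ) / n) ^ 2) :=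
        Finset.sum_le_sum fun j _ => by exact_mod_cast hterm j (x / n)
    _ = (x : ℝ) / n + n * ((x : ℝ) / n) ^ 2 := by
        rw [Finset.sum_add_distrib,
          Fin.sum_univ_eq_sum_range (fun j => if j = 0 then (x : ℝ) / n else 0),
          Finset.sum_ite_eq', if_pos (Finset.mem_range.2 hn), Finset.sum_const, Finset.card_univ,
          Fintype.card_fin, nsmul_eq_mul]
    _ = (x : ℝ) / n + (x : ℝ) ^ 2 / n := by field_simp

lemma tendsto_sum_truncatedGeometric_real_Ici_two (x : ℝ≥0) :
    Tendsto (fun n : ℕ => ∑ j : Fin n, (truncatedGeometric j (x / n)).real (Set.Ici 2))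
      atTop (𝓝 0) := by
  refine squeeze_zero' (Eventually.of_forall fun n => Finset.sum_nonneg fun _ _ =>
    measureReal_nonneg) ?_ (tendsto_const_div_atTop_nhds_zero_nat ((x : ℝ) ^ 2))
  filter_upwards [eventually_gt_atTop 0] with n hn
  have hn' : (n : ℝ) ≠ 0 := Nat.cast_ne_zero.2 hn.ne'
  calc ∑ j : Fin n, (truncatedGeometric j (x / n)).real (Set.Ici 2)
      ≤ ∑ _j : Fin n, ((x : ℝ) / n) ^ 2 :=
        Finset.sum_le_sum fun j _ => by
          exact_mod_cast truncatedGeometric_real_Ici_le j (x / n) 2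
    _ = n * ((x : ℝ) / n) ^ 2 := by
        rw [Finset.sum_const, Finset.card_univ, Fintype.card_fin, nsmul_eq_mul]
    _ = (x : ℝ) ^ 2 / n := by field_simp

lemma tendsto_sum_abs_truncatedGeometric_real_singleton_one_sub (x : ℝ≥0) :
    Tendsto (fun n : ℕ => ∑ j : Fin n,
      |(truncatedGeometric j (x / n)).real {1} - (x : ℝ) / n|) atTop (𝓝 0) := by
  have hsingle (j : ℕ) (q : ℝ≥0) : (truncatedGeometric j q).real {1} =
      (truncatedGeometric j q).real (Set.Ici 1) - (truncatedGeometric j q).real (Set.Ici 2) := by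
    rw [← measureReal_sdiff (Set.Ici_subset_Ici.2 one_le_two) .of_discrete]
    congr 1
    ext m
    simp only [Set.mem_singleton_iff, Set.mem_sdiff, Set.mem_Ici]
    omega
  have hlim := (tendsto_sum_abs_truncatedGeometric_real_Ici_one_sub x).add
    (tendsto_sum_truncatedGeometric_real_Ici_two x)
  rw [add_zero] at hlim
  refine squeeze_zero (fun n => Finset.sum_nonneg fun _ _ => abs_nonneg _) (fun n => ?_) hlim
  rw [← Finset.sum_add_distrib]
  refine Finset.sum_le_sum fun j _ => ?_
  rw [hsingle, sub_right_comm]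
  exact (abs_sub _ _).trans_eq (by rw [abs_of_nonneg (measureReal_nonneg (s := Set.Ici 2))])

end TruncatedGeometricLimits

namespace Mallows

variable {n : ℕ}

section LehmerCode

lemma inv_eq_sum_invAt (σ : Equiv.Perm (Fin n)) : inv σ = ∑ j, invAt j σ := by
  unfold inv invAt
  rw [← Finset.card_sigma]
  refine Finset.card_bij (fun p _ => ⟨p.2, p.1⟩) ?_ ?_ ?_
  · intro p hp
    simpa only [Finset.mem_sigma, Finset.mem_filter, Finset.mem_univ, true_and] using hp
  · rintro ⟨a, b⟩ _ ⟨c, d⟩ _ h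
    simp only [Sigma.mk.injEq, heq_eq_eq] at h
    exact Prod.ext h.2 h.1
  · rintro ⟨b, a⟩ h
    exact ⟨(a, b), by simpa using h, rfl⟩

lemma invAt_le (j : Fin n) (σ : Equiv.Perm (Fin n)) : invAt j σ ≤ j := by
  rw [← Fin.card_Iio j]
  exact Finset.card_le_card fun i hi => Finset.mem_Iio.2 (Finset.mem_filter.1 hi).2.1

lemma invAt_eq_card_values (j : Fin n) (σ : Equiv.Perm (Fin n)) :
    invAt j σ = (Finset.univ.filter fun v => σ j < v ∧ ∀ i, j < i → σ i ≠ v).card := by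
  refine Finset.card_bij (fun i _ => σ i) ?_ (fun _ _ _ _ h => σ.injective h) ?_
  · intro i hi
    simp only [Finset.mem_filter, Finset.mem_univ, true_and] at hi ⊢
    exact ⟨hi.2, fun i' hi' h => (hi.1.trans hi').ne' (σ.injective h)⟩
  · intro v hv
    simp only [Finset.mem_filter, Finset.mem_univ, true_and] at hv
    refine ⟨σ.symm v, ?_, σ.apply_symm_apply v⟩
    simp only [Finset.mem_filter, Finset.mem_univ, true_and, Equiv.apply_symm_apply]
    have hle : σ.symm v ≤ j := not_lt.1 fun h => hv.2 _ h (σ.apply_symm_apply v)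
    have hne : σ.symm v ≠ j := fun h => hv.1.ne (σ.symm_apply_eq.1 h).symm
    exact ⟨lt_of_le_of_ne hle hne, hv.1⟩

lemma invAt_lt_invAt_of_eqOn_Ioi {σ τ : Equiv.Perm (Fin n)} {j : Fin n}
    (h : Set.EqOn σ τ (Set.Ioi j)) (hlt : σ j < τ j) : invAt j τ < invAt j σ := by
  simp only [invAt_eq_card_values]
  refine Finset.card_lt_card ((Finset.ssubset_iff_of_subset ?_).2 ⟨τ j, ?_, ?_⟩)
  · intro v hv
    simp only [Finset.mem_filter, Finset.mem_univ, true_and] at hv ⊢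
    exact ⟨hlt.trans hv.1, fun i hi => (h hi).trans_ne (hv.2 i hi)⟩
  · simp only [Finset.mem_filter, Finset.mem_univ, true_and]
    exact ⟨hlt, fun i hi => (h hi).trans_ne fun e => hi.ne' (τ.injective e)⟩
  · simp only [Finset.mem_filter, lt_irrefl, false_and, and_false, not_false_eq_true]

/-- The Lehmer code of a permutation, the sequence of its inversion counts `Inv_j`. -/
def lehmerCode (σ : Equiv.Perm (Fin n)) (j : Fin n) : ℕ := invAt j σ

lemma lehmerCode_injective : Function.Injective (lehmerCode (n := n)) := by
  intro σ τ h
  have heq (j : Fin n) : σ j = τ j := by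
    induction j using WellFoundedGT.induction with
    | ind j ih =>
      rcases lt_trichotomy (σ j) (τ j) with hlt | heq | hlt
      · exact absurd (congrFun h j) (invAt_lt_invAt_of_eqOn_Ioi (fun i hi => ih i hi) hlt).ne'
      · exact heq
      · exact absurd (congrFun h j)
          (invAt_lt_invAt_of_eqOn_Ioi (fun i hi => (ih i hi).symm) hlt).ne
  exact Equiv.ext heq

lemma exists_lehmerCode_eq_iff {f : Fin n → ℕ} : (∃ σ, lehmerCode σ = f) ↔ ∀ j, f j ≤ j := by
  have himage : Finset.univ.image (lehmerCode (n := n)) =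
      Fintype.piFinset fun j : Fin n => Finset.range (j + 1) := by
    refine Finset.eq_of_subset_of_card_le (fun f hf => ?_) ?_
    · obtain ⟨σ, -, rfl⟩ := Finset.mem_image.1 hf
      exact Fintype.mem_piFinset.2 fun j => Finset.mem_range_succ_iff.2 (invAt_le j σ)
    · rw [Finset.card_image_of_injective _ lehmerCode_injective, Fintype.card_piFinset,
        Finset.card_univ, Fintype.card_perm, Fintype.card_fin]
      simp only [Finset.card_range]
      rw [Fin.prod_univ_eq_prod_range (fun i => i + 1), Finset.prod_range_add_one_eq_factorial]
  simpa only [Finset.mem_image, Finset.mem_univ, true_and, Fintype.mem_piFinset, Finset.mem_range,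
    Nat.lt_succ_iff] using Finset.ext_iff.1 himage f

end LehmerCode

section MallowsMeasure

variable (n) (q : ℝ≥0)

lemma Z_eq_prod_sum : Z n q = ∏ j : Fin n, ∑ l ∈ Finset.range ((j : ℕ) + 1), q ^ l := by
  rw [Z, Fin.prod_univ_eq_prod_range (fun j => ∑ l ∈ Finset.range (j + 1), q ^ l),
    Finset.range_eq_Ico, Finset.prod_Ico_add' (fun k => ∑ l ∈ Finset.range k, q ^ l) 0 n 1]
  rfl

lemma mallowsMeasure_singleton (σ : Equiv.Perm (Fin n)) :
    mallowsMeasure n q {σ} = ((q ^ inv σ / Z n q : ℝ≥0) : ℝ≥0∞) := by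
  rw [mallowsMeasure, Measure.sum_smul_dirac_singleton]

theorem map_lehmerCode_mallowsMeasure :
    (mallowsMeasure n q).map lehmerCode = Measure.pi fun j : Fin n => truncatedGeometric j q := by
  refine Measure.ext_of_singleton fun f => ?_
  rw [Measure.map_apply .of_discrete .of_discrete, Measure.pi_singleton]
  simp only [truncatedGeometric_singleton]
  by_cases hf : ∀ j, f j ≤ j
  · obtain ⟨σ, rfl⟩ := exists_lehmerCode_eq_iff.2 hf
    have hpre : lehmerCode ⁻¹' {lehmerCode σ} = {σ} := by
      ext τ
      exact lehmerCode_injective.eq_iff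
    simp only [hpre, if_pos (hf _), mallowsMeasure_singleton, ← ENNReal.ofNNReal_finsetProd,
      Finset.prod_div_distrib, ← Z_eq_prod_sum, Finset.prod_pow_eq_pow_sum, inv_eq_sum_invAt]
    rfl
  · have hpre : lehmerCode ⁻¹' {f} = ∅ :=
      Set.eq_empty_of_forall_notMem fun σ hσ => hf (exists_lehmerCode_eq_iff.1 ⟨σ, hσ⟩)
    obtain ⟨j, hj⟩ := not_forall.1 hf
    rw [hpre, measure_empty, Finset.prod_eq_zero (Finset.mem_univ j) (if_neg hj)]

instance mallowsMeasure.isProbabilityMeasure : IsProbabilityMeasure (mallowsMeasure n q) where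
  measure_univ := by
    have h := congrArg (· Set.univ) (map_lehmerCode_mallowsMeasure n q)
    simpa only [Measure.map_apply .of_discrete .univ, Set.preimage_univ, measure_univ] using h

theorem map_invAt_mallowsMeasure (j : Fin n) :
    (mallowsMeasure n q).map (invAt j) = truncatedGeometric j q := by
  rw [← (measurePreserving_eval (fun j : Fin n => truncatedGeometric j q) j).map_eq,
    ← map_lehmerCode_mallowsMeasure, Measure.map_map (by fun_prop) .of_discrete]
  rfl

theorem iIndepFun_invAt : iIndepFun (fun j : Fin n => invAt j) (mallowsMeasure n q) := by
  rw [iIndepFun_iff_map_fun_eq_pi_map fun j => Measurable.of_discrete.aemeasurable]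
  simp only [map_invAt_mallowsMeasure]
  exact map_lehmerCode_mallowsMeasure n q

lemma mallowsMeasure_real_invAt_mem (j : Fin n) (A : Set ℕ) :
    (mallowsMeasure n q).real {σ | invAt j σ ∈ A} = (truncatedGeometric j q).real A := by
  rw [← map_invAt_mallowsMeasure, map_measureReal_apply .of_discrete .of_discrete]
  rfl

end MallowsMeasure

section JumpTimes

lemma eventually_le_choose_two (k : ℕ) : ∀ᶠ n : ℕ in atTop, k ≤ n.choose 2 := by
  filter_upwards [eventually_ge_atTop (k + 2)] with n hn
  rw [Nat.choose_two_right, Nat.le_div_iff_mul_le two_pos, mul_comm n]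
  exact Nat.mul_le_mul (by omega) (by omega)

lemma sum_val_eq_choose_two (n : ℕ) : ∑ j : Fin n, (j : ℕ) = n.choose 2 := by
  rw [Fin.sum_univ_eq_sum_range (fun j => j), Finset.sum_range_id, Nat.choose_two_right]

lemma inv_le_choose_two (σ : Equiv.Perm (Fin n)) : inv σ ≤ n.choose 2 := by
  rw [inv_eq_sum_invAt, ← sum_val_eq_choose_two]
  exact Finset.sum_le_sum fun j _ => invAt_le j σ

lemma exists_invAt_lt {σ : Equiv.Perm (Fin n)} (h : inv σ < n.choose 2) :
    ∃ j : Fin n, invAt j σ < j := by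
  rw [inv_eq_sum_invAt, ← sum_val_eq_choose_two] at h
  obtain ⟨j, -, hj⟩ := Finset.exists_lt_of_sum_lt h
  exact ⟨j, hj⟩

lemma mallowsMeasure_real_inv_lt_choose_two_le {q : ℝ≥0} (hq : 0 < q) :
    (mallowsMeasure n q).real {σ | inv σ < n.choose 2} ≤ n / q := by
  calc (mallowsMeasure n q).real {σ | inv σ < n.choose 2}
      ≤ (mallowsMeasure n q).real (⋃ j : Fin n, {σ | invAt j σ ∈ Set.Iio (j : ℕ)}) :=
        measureReal_mono fun σ hσ => Set.mem_iUnion.2 (exists_invAt_lt hσ)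
    _ ≤ ∑ j : Fin n, (mallowsMeasure n q).real {σ | invAt j σ ∈ Set.Iio (j : ℕ)} :=
        measureReal_iUnion_fintype_le _
    _ ≤ ∑ _j : Fin n, 1 / (q : ℝ) := Finset.sum_le_sum fun j _ => by
        rw [mallowsMeasure_real_invAt_mem]
        exact truncatedGeometric_real_Iio_le j hq
    _ = n / q := by
        rw [Finset.sum_const, Finset.card_univ, Fintype.card_fin, nsmul_eq_mul, mul_one_div]

variable {Ω : Type*} [MeasurableSpace Ω] {M : ℝ≥0 → Ω → Equiv.Perm (Fin n)} {P : Measure Ω}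

lemma IsMallowsProcess.measure_mem (hM : IsMallowsProcess M P) (t : ℝ≥0)
    (A : Set (Equiv.Perm (Fin n))) : P {ω | M t ω ∈ A} = mallowsMeasure n t A := by
  rw [← hM.law t, Measure.map_apply (hM.measurable t) .of_discrete]
  rfl

lemma IsMallowsProcess.measureReal_mem (hM : IsMallowsProcess M P) (t : ℝ≥0)
    (A : Set (Equiv.Perm (Fin n))) : P.real {ω | M t ω ∈ A} = (mallowsMeasure n t).real A := by
  rw [measureReal_def, hM.measure_mem, measureReal_def]

lemma IsMallowsProcess.measureReal_invAt_mem (hM : IsMallowsProcess M P) (t : ℝ≥0) (j : Fin n)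
    (A : Set ℕ) : P.real {ω | invAt j (M t ω) ∈ A} = (truncatedGeometric j t).real A :=
  (hM.measureReal_mem t {σ | invAt j σ ∈ A}).trans (mallowsMeasure_real_invAt_mem n t j A)

lemma IsMonotone.ae_monotone_inv (hM : IsMonotone M P) :
    ∀ᵐ ω ∂P, Monotone fun t => inv (M t ω) := by
  filter_upwards [hM.inv_le] with ω hω
  exact monotone_iff_forall_lt.2 fun s t => hω s t

variable [IsFiniteMeasure P]

lemma IsMallowsProcess.ae_inv_zero (hM : IsMallowsProcess M P) : ∀ᵐ ω ∂P, inv (M 0 ω) = 0 := by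
  have h (j : Fin n) : ∀ᵐ ω ∂P, invAt j (M 0 ω) = 0 := by
    have hnull : P.real {ω | invAt j (M 0 ω) ∈ Set.Ici 1} = 0 := by
      rw [hM.measureReal_invAt_mem]
      exact le_antisymm (by simpa using truncatedGeometric_real_Ici_le j 0 1) measureReal_nonneg
    have hae : ∀ᵐ ω ∂P, ω ∉ {ω | invAt j (M 0 ω) ∈ Set.Ici 1} :=
      measure_eq_zero_iff_ae_notMem.1 ((measureReal_eq_zero_iff).1 hnull)
    filter_upwards [hae] with ω hω
    exact Nat.lt_one_iff.1 (not_le.1 hω)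
  filter_upwards [ae_all_iff.2 h] with ω hω
  rw [inv_eq_sum_invAt]
  exact Finset.sum_eq_zero fun j _ => hω j

lemma IsMallowsProcess.ae_exists_le_inv (hM : IsMallowsProcess M P) {k : ℕ}
    (hk : k ≤ n.choose 2) : ∀ᵐ ω ∂P, ∃ t, k ≤ inv (M t ω) := by
  have hle (i : ℕ) : P.real {ω | ¬ ∃ t, k ≤ inv (M t ω)} ≤ (n : ℝ) / ((i + 1 : ℕ) : ℝ) := by
    calc P.real {ω | ¬ ∃ t, k ≤ inv (M t ω)}
        ≤ P.real {ω | M ((i + 1 : ℕ) : ℝ≥0) ω ∈ {σ | inv σ < n.choose 2}} :=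
          measureReal_mono fun ω hω => (not_le.1 (not_exists.1 hω _)).trans_le hk
      _ = (mallowsMeasure n ((i + 1 : ℕ) : ℝ≥0)).real {σ | inv σ < n.choose 2} :=
          hM.measureReal_mem _ _
      _ ≤ (n : ℝ) / ((i + 1 : ℕ) : ℝ) :=
          mallowsMeasure_real_inv_lt_choose_two_le (Nat.cast_pos.2 i.succ_pos)
  have hlim := (tendsto_const_div_atTop_nhds_zero_nat (n : ℝ)).comp (tendsto_add_atTop_nat 1)
  exact (measureReal_eq_zero_iff).1 (le_antisymm (ge_of_tendsto' hlim hle) measureReal_nonneg)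

lemma IsMonotone.ae_sInf_le_iff (hM : IsMonotone M P) {k : ℕ} (hk : k ≤ n.choose 2) :
    ∀ᵐ ω ∂P, ∀ c : ℝ≥0, sInf {t | k ≤ inv (M t ω)} ≤ c ↔ k ≤ inv (M c ω) := by
  filter_upwards [hM.cadlag, hM.ae_monotone_inv, hM.ae_exists_le_inv hk] with ω hcadlag hmono hne c
  exact csInf_setOf_le_le_iff hmono (fun t =>
    (continuous_of_discreteTopology (f := inv)).continuousAt.comp_continuousWithinAt
      (hcadlag.1 t)) hne

lemma IsMonotone.aemeasurable_jumpTime (hM : IsMonotone M P) (k : ℕ) :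
    AEMeasurable (jumpTime M k) P := by
  refine AEMeasurable.coe_nnreal_real (f := fun ω => sInf {t | k ≤ inv (M t ω)}) ?_
  rcases le_or_gt k (n.choose 2) with hk | hk
  · refine aemeasurable_of_nullMeasurableSet_le fun c => ?_
    have hmeas : MeasurableSet {ω | k ≤ inv (M c ω)} :=
      hM.measurable c (.of_discrete (s := {σ | k ≤ inv σ}))
    refine hmeas.nullMeasurableSet.congr ?_
    filter_upwards [hM.ae_sInf_le_iff hk] with ω hω
    exact propext (hω c).symm
  · have hempty (ω : Ω) : {t | k ≤ inv (M t ω)} = ∅ :=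
      Set.eq_empty_of_forall_notMem fun t ht => (hk.trans_le ht).not_ge (inv_le_choose_two _)
    simp only [hempty]
    exact aemeasurable_const

lemma IsMonotone.ae_natCast_mul_jumpTime_le_iff (hM : IsMonotone M P) {k : ℕ} (hk : 0 < k)
    (hkn : k ≤ n.choose 2) : ∀ᵐ ω ∂P, ∀ c : ℝ,
      (n : ℝ) * jumpTime M k ω ≤ c ↔ k ≤ inv (M (c.toNNReal / n) ω) := by
  have hn : (0 : ℝ) < n := by
    refine Nat.cast_pos.2 (Nat.pos_of_ne_zero ?_)
    rintro rfl
    exact hk.not_ge hkn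
  filter_upwards [hM.ae_inv_zero, hM.ae_sInf_le_iff hkn] with ω hzero hle c
  rcases lt_or_ge c 0 with hc | hc
  · rw [Real.toNNReal_of_nonpos hc.le, zero_div, hzero]
    exact iff_of_false (hc.trans_le (mul_nonneg hn.le (NNReal.coe_nonneg _))).not_ge hk.not_ge
  · rw [← hle, jumpTime, ← NNReal.coe_le_coe, NNReal.coe_div, Real.coe_toNNReal c hc,
      NNReal.coe_natCast, le_div_iff₀' hn]

end JumpTimes

section PoissonPointProcess

/-- The number of points of `S` in `[0, t]`, with junk value `0` when there are infinitely many. -/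
noncomputable def count (S : Set ℝ) (t : ℝ≥0) : ℕ := (S ∩ Set.Icc 0 (t : ℝ)).encard.toNat

section LocallyFinite

variable {S : Set ℝ} (hfin : ∀ t : ℝ, (S ∩ Set.Icc 0 t).Finite)

include hfin

lemma natCast_count (t : ℝ≥0) : (count S t : ℕ∞) = (S ∩ Set.Icc 0 (t : ℝ)).encard :=
  ENat.natCast_toNat (Set.encard_ne_top_iff.2 (hfin t))

lemma monotone_count : Monotone (count S) := fun s t hst => by
  rw [← Nat.cast_le (α := ℕ∞), natCast_count hfin, natCast_count hfin]
  exact Set.encard_le_encard (Set.inter_subset_inter_right _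
    (Set.Icc_subset_Icc_right (NNReal.coe_le_coe.2 hst)))

lemma count_sub_count {s t : ℝ≥0} (hst : s ≤ t) :
    count S t - count S s = (S ∩ Set.Ioc (s : ℝ) t).encard.toNat := by
  have hunion : S ∩ Set.Icc 0 (t : ℝ) = (S ∩ Set.Icc 0 (s : ℝ)) ∪ (S ∩ Set.Ioc (s : ℝ) t) := by
    rw [← Set.inter_union_distrib_left,
      Set.Icc_union_Ioc_eq_Icc (NNReal.coe_nonneg _) (NNReal.coe_le_coe.2 hst)]
  have hdisj : Disjoint (S ∩ Set.Icc 0 (s : ℝ)) (S ∩ Set.Ioc (s : ℝ) t) :=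
    Set.disjoint_left.2 fun x hx hx' => hx'.2.1.not_ge hx.2.2
  have hfin' : (S ∩ Set.Ioc (s : ℝ) t).Finite :=
    (hfin t).subset (hunion ▸ Set.subset_union_right)
  rw [count, count, hunion, Set.encard_union_eq hdisj, ENat.toNat_add
    (Set.encard_ne_top_iff.2 (hfin s)) (Set.encard_ne_top_iff.2 hfin'), add_tsub_cancel_left]

lemma exists_inter_Icc_eq_inter_Icc {t : ℝ} (ht : 0 ≤ t) :
    ∃ s, t < s ∧ S ∩ Set.Icc 0 s = S ∩ Set.Icc 0 t := by
  have hfin' : (S ∩ Set.Ioc t (t + 1)).Finite := (hfin (t + 1)).subset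
    (Set.inter_subset_inter_right _ fun x hx => ⟨ht.trans hx.1.le, hx.2⟩)
  have hbelow : ∀ᶠ s in 𝓝[>] t, ∀ x ∈ S ∩ Set.Ioc t (t + 1), s < x :=
    (eventually_all_finite hfin').2 fun x hx => nhdsWithin_le_nhds (eventually_lt_nhds hx.2.1)
  have hlt : ∀ᶠ s in 𝓝[>] t, s < t + 1 :=
    nhdsWithin_le_nhds (eventually_lt_nhds (lt_add_one t))
  obtain ⟨s, ⟨hs, hs1⟩, hts⟩ := ((hbelow.and hlt).and self_mem_nhdsWithin).exists
  refine ⟨s, hts, Set.Subset.antisymm (fun x hx => ⟨hx.1, hx.2.1, not_lt.1 fun htx => ?_⟩)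
    (Set.inter_subset_inter_right _ (Set.Icc_subset_Icc_right (le_of_lt hts)))⟩
  exact (hs x ⟨hx.1, htx, hx.2.2.trans hs1.le⟩).not_ge hx.2.2

lemma nthPoint_le_iff (hzero : count S 0 = 0) {i : ℕ} (hi : 0 < i)
    (hne : ∃ t : ℝ≥0, i ≤ count S t) (c : ℝ) :
    nthPoint S i ≤ c ↔ i ≤ count S c.toNNReal := by
  have hcount (t : ℝ≥0) : (i : ℕ∞) ≤ (S ∩ Set.Icc 0 (t : ℝ)).encard ↔ i ≤ count S t := by
    rw [← natCast_count hfin, Nat.cast_le]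
  have hmem : nthPoint S i ≤ c ↔ 0 ≤ c ∧ (i : ℕ∞) ≤ (S ∩ Set.Icc 0 c).encard := by
    refine csInf_le_iff_mem ⟨0, fun t ht => ht.1⟩ ?_ ?_ ?_
    · obtain ⟨t, ht⟩ := hne
      exact ⟨t, t.2, (hcount t).2 ht⟩
    · exact fun s t hst hs => ⟨hs.1.trans hst, hs.2.trans (Set.encard_le_encard
        (Set.inter_subset_inter_right _ (Set.Icc_subset_Icc_right hst)))⟩
    · intro t ht
      have ht0 : 0 ≤ t := le_of_forall_gt_imp_ge_of_dense fun s hs => (ht s hs).1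
      obtain ⟨s, hts, hs⟩ := exists_inter_Icc_eq_inter_Icc hfin ht0
      exact ⟨ht0, hs ▸ (ht s hts).2⟩
  rw [hmem]
  rcases lt_or_ge c 0 with hc | hc
  · rw [Real.toNNReal_of_nonpos hc.le, hzero]
    exact iff_of_false (fun h => hc.not_ge h.1) hi.not_ge
  · rw [← hcount, Real.coe_toNNReal c hc, and_iff_right hc]

end LocallyFinite

namespace IsPoissonPointProcess

variable {Ω : Type*} [MeasurableSpace Ω] {N : Ω → Set ℝ} {lam : ℝ≥0} {P : Measure Ω}

lemma measurable_toNat_encard (hN : IsPoissonPointProcess N lam P) {B : Set ℝ}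
    (hB : MeasurableSet B) : Measurable fun ω => (N ω ∩ B).encard.toNat :=
  (measurable_of_countable ENat.toNat).comp (hN.measurable B hB)

lemma measurable_count (hN : IsPoissonPointProcess N lam P) (t : ℝ≥0) :
    Measurable fun ω => count (N ω) t :=
  hN.measurable_toNat_encard measurableSet_Icc

variable [IsProbabilityMeasure P]

lemma ae_encard_ne_top (hN : IsPoissonPointProcess N lam P) {B : Set ℝ} (hB : MeasurableSet B)
    (hB0 : B ⊆ Set.Ici 0) (hvol : volume B ≠ ∞) : ∀ᵐ ω ∂P, (N ω ∩ B).encard ≠ ⊤ := by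
  have hfinite : {ω | (N ω ∩ B).encard ≠ ⊤} = ⋃ m : ℕ, {ω | (N ω ∩ B).encard = m} := by
    ext ω
    simp only [Set.mem_ofPred_eq, Set.mem_iUnion, ENat.ne_top_iff_exists, eq_comm]
  have hmeas (m : ℕ) : MeasurableSet {ω | (N ω ∩ B).encard = m} :=
    hN.measurable B hB (measurableSet_singleton (m : ℕ∞))
  have hdisj : Pairwise (Function.onFun Disjoint fun m : ℕ => {ω | (N ω ∩ B).encard = m}) :=
    fun a b hab => Set.disjoint_left.2 fun ω ha hb => hab (Nat.cast_injective (ha.symm.trans hb))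
  have hone : P {ω | (N ω ∩ B).encard ≠ ⊤} = 1 := by
    rw [hfinite, measure_iUnion hdisj hmeas]
    simp only [hN.law B hB hB0 hvol]
    rw [← measure_iUnion (fun _ _ hab => Set.disjoint_singleton.2 hab) fun _ => .of_discrete,
      Set.iUnion_of_singleton, measure_univ]
  exact (prob_compl_eq_zero_iff (hfinite ▸ MeasurableSet.iUnion hmeas)).2 hone

lemma map_toNat_encard (hN : IsPoissonPointProcess N lam P) {B : Set ℝ} (hB : MeasurableSet B)
    (hB0 : B ⊆ Set.Ici 0) (hvol : volume B ≠ ∞) :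
    P.map (fun ω => (N ω ∩ B).encard.toNat) = poissonMeasure (lam * (volume B).toNNReal) := by
  refine Measure.ext_of_singleton fun m => ?_
  rw [Measure.map_apply (hN.measurable_toNat_encard hB) (measurableSet_singleton m),
    ← hN.law B hB hB0 hvol m]
  refine measure_congr ?_
  filter_upwards [hN.ae_encard_ne_top hB hB0 hvol] with ω hω
  refine propext ?_
  change (N ω ∩ B).encard.toNat = m ↔ (N ω ∩ B).encard = m
  rw [← ENat.natCast_toNat hω, ENat.toNat_natCast, Nat.cast_inj]

lemma map_count (hN : IsPoissonPointProcess N lam P) (t : ℝ≥0) :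
    P.map (fun ω => count (N ω) t) = poissonMeasure (lam * t) := by
  simpa [count] using hN.map_toNat_encard (B := Set.Icc 0 (t : ℝ)) measurableSet_Icc
    Set.Icc_subset_Ici_self (by simp)

lemma ae_locallyFinite (hN : IsPoissonPointProcess N lam P) :
    ∀ᵐ ω ∂P, ∀ t : ℝ, (N ω ∩ Set.Icc 0 t).Finite := by
  have h : ∀ᵐ ω ∂P, ∀ m : ℕ, (N ω ∩ Set.Icc 0 (m : ℝ)).encard ≠ ⊤ := ae_all_iff.2 fun m =>
    hN.ae_encard_ne_top measurableSet_Icc Set.Icc_subset_Ici_self measure_Icc_lt_top.ne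
  filter_upwards [h] with ω hω t
  obtain ⟨m, hm⟩ := exists_nat_ge t
  exact (Set.encard_ne_top_iff.1 (hω m)).subset
    (Set.inter_subset_inter_right _ (Set.Icc_subset_Icc_right hm))

lemma ae_count_zero (hN : IsPoissonPointProcess N lam P) : ∀ᵐ ω ∂P, count (N ω) 0 = 0 := by
  have h : ∀ᵐ m ∂(P.map fun ω => count (N ω) 0), m = 0 := by
    rw [hN.map_count, mul_zero, poissonMeasure_zero]
    exact (ae_dirac_iff (measurableSet_singleton 0)).2 rfl
  exact ae_of_ae_map (hN.measurable_count 0).aemeasurable h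

lemma ae_exists_le_count (hN : IsPoissonPointProcess N lam P) (hlam : 0 < lam) (i : ℕ) :
    ∀ᵐ ω ∂P, ∃ t : ℝ≥0, i ≤ count (N ω) t := by
  have hlim : Tendsto (fun t => poissonMeasure (lam * t) (Set.Iio i)) atTop (𝓝 0) :=
    (tendsto_poissonMeasure_Iio i).comp (tendsto_id.const_mul_atTop hlam)
  rw [ae_iff]
  refine le_antisymm (ge_of_tendsto' hlim fun t => ?_) zero_le
  rw [← hN.map_count t, Measure.map_apply (hN.measurable_count t) .of_discrete]
  exact measure_mono fun ω hω => not_le.1 (not_exists.1 hω t)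

lemma ae_nthPoint_le_iff (hN : IsPoissonPointProcess N lam P) (hlam : 0 < lam) {i : ℕ}
    (hi : 0 < i) : ∀ᵐ ω ∂P, ∀ c, nthPoint (N ω) i ≤ c ↔ i ≤ count (N ω) c.toNNReal := by
  filter_upwards [hN.ae_locallyFinite, hN.ae_count_zero, hN.ae_exists_le_count hlam i]
    with ω hfin hzero hne
  exact nthPoint_le_iff hfin hzero hi hne

lemma aemeasurable_nthPoint (hN : IsPoissonPointProcess N lam P) (hlam : 0 < lam) {i : ℕ}
    (hi : 0 < i) : AEMeasurable (fun ω => nthPoint (N ω) i) P := by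
  refine aemeasurable_of_nullMeasurableSet_le fun c => ?_
  have hmeas : MeasurableSet {ω | i ≤ count (N ω) c.toNNReal} :=
    measurableSet_le measurable_const (hN.measurable_count _)
  refine hmeas.nullMeasurableSet.congr ?_
  filter_upwards [hN.ae_nthPoint_le_iff hlam hi] with ω hω
  exact propext (hω c).symm

lemma measure_count_increments (hN : IsPoissonPointProcess N lam P) {m : ℕ}
    {t : Fin (m + 1) → ℝ≥0} (ht : Monotone t) (A : Set (Fin m → ℕ)) :
    P {ω | (fun l => count (N ω) (t l.succ) - count (N ω) (t l.castSucc)) ∈ A} =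
      poissonPi (fun l : Fin m => lam * (t l.succ - t l.castSucc)) A := by
  let B (l : Fin m) : Set ℝ := Set.Ioc (t l.castSucc : ℝ) (t l.succ)
  have hB0 (l : Fin m) : B l ⊆ Set.Ici 0 := fun x hx => (NNReal.coe_nonneg _).trans hx.1.le
  have hdisj : Pairwise (Function.onFun Disjoint B) :=
    (pairwise_disjoint_on B).2 fun l l' hll => Set.Ioc_disjoint_Ioc_of_le
      (NNReal.coe_le_coe.2 (ht (Fin.succ_le_castSucc_iff.2 hll)))
  have hmeas (l : Fin m) := hN.measurable_toNat_encard (B := B l) measurableSet_Ioc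
  have hind : iIndepFun (fun l ω => (N ω ∩ B l).encard.toNat) P :=
    (hN.indep m B (fun _ => measurableSet_Ioc) hdisj).comp (fun _ => ENat.toNat)
      fun _ => measurable_of_countable _
  have hlaw : P.map (fun ω l => (N ω ∩ B l).encard.toNat) =
      poissonPi fun l : Fin m => lam * (t l.succ - t l.castSucc) := by
    rw [(iIndepFun_iff_map_fun_eq_pi_map fun l => (hmeas l).aemeasurable).1 hind, poissonPi]
    congr 1 with l : 1
    rw [hN.map_toNat_encard measurableSet_Ioc (hB0 l) measure_Ioc_lt_top.ne, Real.volume_Ioc,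
      ← NNReal.coe_sub (ht l.castSucc_lt_succ.le), ENNReal.ofReal_coe_nnreal,
      ENNReal.toNNReal_coe]
  rw [← hlaw, Measure.map_apply (measurable_pi_lambda _ hmeas) .of_discrete]
  refine measure_congr ?_
  filter_upwards [hN.ae_locallyFinite] with ω hfin
  refine congrArg (· ∈ A) (funext fun l => ?_)
  exact count_sub_count hfin (ht l.castSucc_lt_succ.le)

end IsPoissonPointProcess

end PoissonPointProcess

section PoissonLimits

theorem tendsto_mallowsMeasure_inv_mem (x : ℝ≥0) (A : Set ℕ) :
    Tendsto (fun n : ℕ => mallowsMeasure n (x / n) {σ | inv σ ∈ A}) atTop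
      (𝓝 (poissonMeasure x A)) := by
  have hpoisson : poissonPi (fun _ : Unit => x) {y | y () ∈ A} = poissonMeasure x A :=
    (measurePreserving_eval (fun _ : Unit => poissonMeasure x) ()).measure_preimage
      MeasurableSet.of_discrete.nullMeasurableSet
  have hsum (n : ℕ) (σ : Equiv.Perm (Fin n)) : (∑ j, fun _ : Unit => invAt j σ) () = inv σ := by
    rw [Finset.sum_apply, inv_eq_sum_invAt]
  have hlim := tendsto_measure_sum_mem_poissonPi (P := fun n : ℕ => mallowsMeasure n (x / n))
    (X := fun n j σ (_ : Unit) => invAt j σ) (fun _ _ => .of_discrete)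
    (fun n => (iIndepFun_invAt n (x / n)).comp (fun _ a _ => a) fun _ => .of_discrete)
    (fun _ => x) (fun l => ?_) ?_ {y | y () ∈ A}
  · simpa only [hpoisson, Set.mem_ofPred_eq, hsum] using hlim
  · have hset (n : ℕ) (j : Fin n) :
        {σ | (fun _ : Unit => invAt j σ) = Pi.single l 1} = {σ | invAt j σ ∈ ({1} : Set ℕ)} := by
      ext σ
      simp [funext_iff]
    simpa only [hset, mallowsMeasure_real_invAt_mem]
      using tendsto_sum_abs_truncatedGeometric_real_singleton_one_sub x
  · refine (tendsto_sum_truncatedGeometric_real_Ici_two x).congr fun n => ?_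
    refine Finset.sum_congr rfl fun j _ => ?_
    rw [← mallowsMeasure_real_invAt_mem]
    simp only [Fintype.sum_unique, Set.mem_Ici]

theorem tendsto_measure_inv_increments_mem {Ω : ℕ → Type*} [∀ n, MeasurableSpace (Ω n)]
    {P : ∀ n, Measure (Ω n)} [∀ n, IsProbabilityMeasure (P n)]
    {M : ∀ n, ℝ≥0 → Ω n → Equiv.Perm (Fin n)} (hM : ∀ n, IsStronglyMonotone (M n) (P n))
    (hind : ∀ n, iIndepFun (fun (j : Fin n) ω t => invAt j (M n t ω)) (P n)) {m : ℕ}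
    {t : Fin (m + 1) → ℝ≥0} (ht : Monotone t) (A : Set (Fin m → ℕ)) :
    Tendsto (fun n => P n {ω | (fun l : Fin m =>
        inv (M n (t l.succ / n) ω) - inv (M n (t l.castSucc / n) ω)) ∈ A}) atTop
      (𝓝 (poissonPi (fun l : Fin m => t l.succ - t l.castSucc) A)) := by
  simp only [inv_eq_sum_invAt]
  refine tendsto_measure_sum_increments_mem_poissonPi
    (V := fun n j ω l => invAt j (M n (t l / n) ω)) (fun n j => ?_)
    (fun n => (hind n).comp (fun _ f l => f (t l / n)) fun _ => by fun_prop) (fun n => ?_) ht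
    (fun l => ?_) ?_ A
  · exact measurable_pi_lambda _ fun l =>
      (Measurable.of_discrete (f := invAt j)).comp ((hM n).measurable _)
  · filter_upwards [(hM n).invAt_le] with ω hω j
    have hmono : Monotone fun s => invAt j (M n s ω) := monotone_iff_forall_lt.2 fun s t => hω j s t
    exact fun l l' hll => hmono (div_le_div_of_nonneg_right (ht hll) zero_le)
  · refine (tendsto_sum_abs_truncatedGeometric_real_Ici_one_sub (t l)).congr fun n => ?_
    exact Finset.sum_congr rfl fun j _ => by
      rw [← (hM n).measureReal_invAt_mem]
      rfl
  · refine (tendsto_sum_truncatedGeometric_real_Ici_two (t (Fin.last m))).congr fun n => ?_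
    exact Finset.sum_congr rfl fun j _ => by
      rw [← (hM n).measureReal_invAt_mem]
      rfl

end PoissonLimits

section JumpTimeLimits

variable {Ω : ℕ → Type*} [∀ n, MeasurableSpace (Ω n)] {P : ∀ n, Measure (Ω n)}
  [∀ n, IsProbabilityMeasure (P n)] {M : ∀ n, ℝ≥0 → Ω n → Equiv.Perm (Fin n)}

theorem tendsto_measure_natCast_mul_jumpTime_le (hM : ∀ n, IsMonotone (M n) (P n)) {k : ℕ}
    (hk : 0 < k) (c : ℝ) : Tendsto (fun n => P n {ω | (n : ℝ) * jumpTime (M n) k ω ≤ c}) atTop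
      (𝓝 (gammaMeasure k 1 (Set.Iic c))) := by
  rw [← poissonMeasure_Ici_eq_gammaMeasure_Iic hk]
  refine (tendsto_mallowsMeasure_inv_mem c.toNNReal (Set.Ici k)).congr' ?_
  filter_upwards [eventually_le_choose_two k] with n hn
  rw [← (hM n).measure_mem]
  refine measure_congr ?_
  filter_upwards [(hM n).ae_natCast_mul_jumpTime_le_iff hk hn] with ω hω
  exact propext (hω c).symm

theorem tendsto_measure_restrict_inv (hM : ∀ n, IsStronglyMonotone (M n) (P n))
    (hind : ∀ n, iIndepFun (fun (j : Fin n) ω t => invAt j (M n t ω)) (P n)) {Ω' : Type*}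
    [MeasurableSpace Ω'] {P' : Measure Ω'} [IsProbabilityMeasure P'] {N : Ω' → Set ℝ}
    (hN : IsPoissonPointProcess N 1 P') (s : Finset ℝ≥0) (A : Set (s → ℕ)) :
    Tendsto (fun n => P n {ω | s.restrict (fun t => inv (M n (t / n) ω)) ∈ A}) atTop
      (𝓝 (P' {ω | s.restrict (count (N ω)) ∈ A})) := by
  refine tendsto_measure_restrict_of_tendsto_increments (X := fun n t ω => inv (M n (t / n) ω))
    (Y := fun t ω => count (N ω) t) (fun n => ?_) (fun n => ?_) hN.ae_count_zero ?_
    (fun m t ht _ A => ?_) s A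
  · simpa only [zero_div] using (hM n).ae_inv_zero
  · filter_upwards [(hM n).ae_monotone_inv] with ω hω
    exact fun s t hst => hω (div_le_div_of_nonneg_right hst zero_le)
  · filter_upwards [hN.ae_locallyFinite] with ω hω
    exact monotone_count hω
  · simpa only [hN.measure_count_increments ht, one_mul]
      using tendsto_measure_inv_increments_mem hM hind ht A

end JumpTimeLimits

end Mallows

theorem theorem1p3_general {Ω : ℕ → Type*} [∀ n, MeasurableSpace (Ω n)]
    (P : ∀ n, Measure (Ω n)) [∀ n, IsProbabilityMeasure (P n)]
    (M : ∀ n, ℝ≥0 → Ω n → Equiv.Perm (Fin n))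
    (hM : ∀ n, Mallows.IsMonotone (M n) (P n))
    (k : ℕ) (hk : 0 < k) :
    (haveI : IsProbabilityMeasure (gammaMeasure (k : ℝ) 1) :=
        isProbabilityMeasure_gammaMeasure (Nat.cast_pos.2 hk) one_pos;
      TendstoInDistribution (fun (n : ℕ) (ω : Ω n) => (n : ℝ) * Mallows.jumpTime (M n) k ω)
        atTop (id : ℝ → ℝ) P (gammaMeasure (k : ℝ) 1)) ∧
    ((∀ n, Mallows.IsStronglyMonotone (M n) (P n)) →
      (∀ n, iIndepFun (fun (j : Fin n) (ω : Ω n) (t : ℝ≥0) => Mallows.invAt j (M n t ω)) (P n)) →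
      ∀ (Ω' : Type*) [MeasurableSpace Ω'] (P' : Measure Ω') [IsProbabilityMeasure P']
        (N : Ω' → Set ℝ), Mallows.IsPoissonPointProcess N 1 P' →
        TendstoInDistribution
          (fun (n : ℕ) (ω : Ω n) (i : Fin k) => (n : ℝ) * Mallows.jumpTime (M n) ((i : ℕ) + 1) ω)
          atTop (fun (ω : Ω') (i : Fin k) => Mallows.nthPoint (N ω) ((i : ℕ) + 1)) P P') := by
  have hmeas (n i : ℕ) : AEMeasurable (fun ω => (n : ℝ) * Mallows.jumpTime (M n) i ω) (P n) :=
    ((hM n).aemeasurable_jumpTime i).const_mul _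
  refine ⟨?_, fun hstrong hind Ω' _ P' _ N hN => ?_⟩
  · have : IsProbabilityMeasure (gammaMeasure (k : ℝ) 1) :=
      isProbabilityMeasure_gammaMeasure (Nat.cast_pos.2 hk) one_pos
    exact tendstoInDistribution_of_tendsto_le (fun n => hmeas n k) aemeasurable_id
      (Mallows.tendsto_measure_natCast_mul_jumpTime_le hM hk)
  · refine tendstoInDistribution_hittingTimes (κ := fun i : Fin k => (i : ℕ) + 1)
      (X := fun n t ω => Mallows.inv (M n (t / n) ω)) (Y := fun t ω => Mallows.count (N ω) t)
      (Mallows.tendsto_measure_restrict_inv hstrong hind hN)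
      (fun n => aemeasurable_pi_lambda _ fun i => hmeas n _)
      (aemeasurable_pi_lambda _ fun i => hN.aemeasurable_nthPoint one_pos i.val.succ_pos) ?_
      (ae_all_iff.2 fun i => hN.ae_nthPoint_le_iff one_pos i.val.succ_pos)
    filter_upwards [Mallows.eventually_le_choose_two k] with n hn
    exact ae_all_iff.2 fun i =>
      (hM n).ae_natCast_mul_jumpTime_le_iff i.val.succ_pos (i.is_lt.trans_le hn)

theorem theorem1p3 {Ω : ℕ → Type*} [∀ n, MeasurableSpace (Ω n)]
    (P : ∀ n, Measure (Ω n)) [∀ n, IsProbabilityMeasure (P n)]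
    (M : ∀ n, ℝ≥0 → Ω n → Equiv.Perm (Fin n))
    (hM : ∀ n, Mallows.IsMonotone (M n) (P n))
    (k : ℕ) (hk : 0 < k) :
    (haveI : IsProbabilityMeasure (gammaMeasure (k : ℝ) 1) :=
        isProbabilityMeasure_gammaMeasure (Nat.cast_pos.2 hk) one_pos;
      TendstoInDistribution (fun (n : ℕ) (ω : Ω n) => (n : ℝ) * Mallows.jumpTime (M n) k ω)
        atTop (id : ℝ → ℝ) P (gammaMeasure (k : ℝ) 1)) ∧
    ((∀ n, Mallows.IsRegular (M n) (P n)) →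
      ∀ (Ω' : Type*) [MeasurableSpace Ω'] (P' : Measure Ω') [IsProbabilityMeasure P']
        (N : Ω' → Set ℝ), Mallows.IsPoissonPointProcess N 1 P' →
        TendstoInDistribution
          (fun (n : ℕ) (ω : Ω n) (i : Fin k) => (n : ℝ) * Mallows.jumpTime (M n) ((i : ℕ) + 1) ω)
          atTop (fun (ω : Ω') (i : Fin k) => Mallows.nthPoint (N ω) ((i : ℕ) + 1)) P P') := by
  obtain ⟨hgamma, hpoisson⟩ := theorem1p3_general P M hM k hk
  exact ⟨hgamma, fun hreg =>
    hpoisson (fun n => (hreg n).toIsStronglyMonotone) fun n => (hreg n).indep⟩
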